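/- Let $\mathcal D$ be a triangulated category. A bounded t-structure on $\mathcal D$ is identified with its aisle $\mathcal C=\mathcal D^{\le 0}$, so $\mathcal C[1]\subset\mathcal C$, and bounded t-structures are ordered by inclusion of aisles. Its heart $\mathcal A$ is called *algebraic* if every object of $\mathcal A$ is artinian and noetherian and $\mathcal A$ has only finitely many simple objects up to isomorphism. All subcategories below are full and closed under isomorphisms. A *torsion pair* in $\mathcal A$ is a pair $(\mathcal T,\mathcal F)$ of subcategories with $\mathrm{Hom}(T,F)=0$ for all $T\in\mathcal T$, $F\in\mathcal F$, such that every object $E$ of $\mathcal A$ fits into a short exact sequence $0\to T\to E\to F\to 0$ with $T\in\mathcal T$, $F\in\mathcal F$; then $\mathcal T$ is called a *torsion class*. The *left tilt* of the t-structure with respect to $(\mathcal T,\mathcal F)$ is the bounded t-structure with heart $$\{E\in\mathcal D \mid H^i(E)=0 \text{ for } i\notin\{0,1\},\ H^0(E)\in\mathcal F,\ H^1(E)\in\mathcal T\},$$ where $H^i$ denotes cohomology with respect to the original t-structure. If $\mathcal A$ is algebraic and $S\in\mathcal A$ is simple, the *simple (left) tilt* at $S$ is the left tilt with respect to the torsion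 pair $(\langle S\rangle,\{E\in\mathcal A\mid\mathrm{Hom}(S,E)=0\})$, where $\langle S\rangle$ is the extension closure of $S$ (including $0$). An algebraic heart $\mathcal A$ with $n$ simple objects *can be tilted indefinitely* if every heart obtained from it by a finite sequence of simple tilts is again algebraic with $n$ simple objects. An object $E\in\mathcal A$ is *endo-trivial* if $\mathrm{End}(E)$ is a skew field. The bounded t-structures $\mathcal C'$ with $\mathcal C\subset\mathcal C'\subset\mathcal C[-1]$ are called *intermediate* (with respect to the t-structure $\mathcal C$ with heart $\mathcal A$). The *exchange quiver* of $\mathcal A$ has the intermediate t-structures as vertices and an arrow $\mathcal C_1\to\mathcal C_2$ whenever $\mathcal C_2$ is obtained from $\mathcal C_1$ by a simple tilt. The *Hasse quiver* of torsion classes in $\mathcal A$ has the torsion classes as vertices and an arrow $\mathcal T_1\to\mathcal T_2$ whenever $\mathcal T_2\subsetneq\mathcal T_1$ and no torsion class lies strictly between them. **Proposition.** Let $\mathcal A$ be an algebraic heart of a bounded t-structure on a triangulated category $\mathcal D$ that can be tilted indefinitely. Suppose that the set of classes in the Grothendieck group $K(\mathcal A)=K(\mathcal D)$ of endo-trivial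 objects of $\mathcal A$ is finite, or that $\mathcal A$ has only finitely many torsion classes. Then the Hasse quiver of torsion classes in $\mathcal A$ coincides with the opposite of the exchange quiver of $\mathcal A$. Precisely: sending a torsion class $\mathcal T$ to the left tilt $\mathcal C_{\mathcal T}$ with respect to its torsion pair is an isomorphism of posets from the torsion classes in $\mathcal A$ (ordered by inclusion) to the intermediate t-structures, and for all torsion classes $\mathcal T_1,\mathcal T_2$ there is an arrow $\mathcal T_1\to\mathcal T_2$ in the Hasse quiver if and only if there is an arrow $\mathcal C_{\mathcal T_2}\to\mathcal C_{\mathcal T_1}$ in the exchange quiver. -/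

import Mathlib

open CategoryTheory CategoryTheory.Limits CategoryTheory.Triangulated
open CategoryTheory.Pretriangulated

universe v u

noncomputable section

namespace HeartTilting

/-! ### Notions in an abelian category (applied below to hearts of t-structures) -/

section Abelian

variable {A : Type u} [Category.{v} A] [HasZeroMorphisms A]

/-- The Gabriel product `P ⋆ Q`: the objects `E` that fit into a short exact sequence
`0 ⟶ X ⟶ E ⟶ Y ⟶ 0` with `X` in `P` and `Y` in `Q`. -/
def gabrielProduct (P Q : ObjectProperty A) : ObjectProperty A := fun E =>
  ∃ (X Y : A) (f : X ⟶ E) (g : E ⟶ Y) (w : f ≫ g = 0),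
    P X ∧ Q Y ∧ (ShortComplex.mk f g w).ShortExact

/-- Torsion pairs. Full subcategories are closed under isomorphisms. -/
structure IsTorsionPair (T F : ObjectProperty A) : Prop where
  closedUnderIso_torsion : T.IsClosedUnderIsomorphisms
  closedUnderIso_torsionFree : F.IsClosedUnderIsomorphisms
  hom_eq_zero : ∀ ⦃X Y : A⦄ (f : X ⟶ Y), T X → F Y → f = 0
  exists_shortExact : ∀ E : A, gabrielProduct T F E

/-- A torsion class is the first member of a torsion pair. -/
def IsTorsionClass (T : ObjectProperty A) : Prop :=
  ∃ F : ObjectProperty A, IsTorsionPair T F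

/-- The extension-closed full subcategory `⟨S⟩` generated by an object `S`
(closed under isomorphisms and containing the zero objects). -/
inductive extClosure (S : A) : ObjectProperty A
  | zero (X : A) (hX : IsZero X) : extClosure S X
  | self : extClosure S S
  | iso (X Y : A) (e : X ≅ Y) (hX : extClosure S X) : extClosure S Y
  | ext (E : ShortComplex A) (hE : E.ShortExact) (h₁ : extClosure S E.X₁)
      (h₃ : extClosure S E.X₃) : extClosure S E.X₂

/-- The objects `E` with `Hom(S, E) = 0`. -/
def homOrthogonal (S : A) : ObjectProperty A := fun E => ∀ f : S ⟶ E, f = 0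

variable (A) in
/-- The set of isomorphism classes of simple objects. -/
def simpleClasses : Set (Quotient (isIsomorphicSetoid A)) :=
  {c | ∃ S : A, Simple S ∧ Quotient.mk (isIsomorphicSetoid A) S = c}

end Abelian

/-- An object is endo-trivial if its endomorphism ring is a skew field. -/
def IsEndoTrivial {A : Type u} [Category.{v} A] [Preadditive A] (E : A) : Prop :=
  Nontrivial (End E) ∧ ∀ f : End E, f ≠ 0 → IsUnit f

/-! ### Triangulated categories -/

section Triangulated

variable {D : Type u} [Category.{v} D] [Preadditive D] [HasZeroObject D] [HasShift D ℤ]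
  [∀ n : ℤ, (shiftFunctor D n).Additive] [Pretriangulated D]

variable (D) in
/-- The relations `[X₂] - [X₁] - [X₃]` for all distinguished triangles `X₁ ⟶ X₂ ⟶ X₃ ⟶ X₁⟦1⟧`. -/
def grothendieckRelations : AddSubgroup (FreeAbelianGroup D) :=
  AddSubgroup.closure {x | ∃ T ∈ distTriang D,
    x = FreeAbelianGroup.of T.obj₂ - FreeAbelianGroup.of T.obj₁ - FreeAbelianGroup.of T.obj₃}

variable (D) in
/-- The Grothendieck group `K(D)` of a triangulated category. For the heart `A` of a bounded
t-structure on `D`, the inclusion identifies `K(A)` with `K(D)`. -/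
abbrev GrothendieckGroup : Type u := FreeAbelianGroup D ⧸ grothendieckRelations D

/-- The class of an object in the Grothendieck group. -/
def grothendieckClass (X : D) : GrothendieckGroup D :=
  QuotientAddGroup.mk (FreeAbelianGroup.of X)

variable (t : TStructure D)

/-- The heart of a t-structure, as a category. -/
abbrev HeartCat : Type u := t.heart.FullSubcategory

/-- The t-structure is bounded: every object lies in some `D^{≤ n}` and in some `D^{≥ m}`. -/
def IsBounded : Prop := t.bounded = ⊤

/-- The cohomology object `Hⁱ(E)` with respect to `t`, namely `(τ^{≥ i} τ^{≤ i} E)⟦i⟧`. -/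
def cohomology (i : ℤ) (E : D) : D := ((t.truncGELE i i).obj E)⟦i⟧

/-- The heart is algebraic: it has finite length (all objects are artinian and noetherian)
and finitely many simple objects up to isomorphism. -/
def IsAlgebraicHeart : Prop :=
  (∀ E : HeartCat t, isArtinianObject E ∧ isNoetherianObject E) ∧
    (simpleClasses (HeartCat t)).Finite

/-- The objects `E` of `D` with `Hⁱ(E) = 0` for `i ∉ {0, 1}`, `H⁰(E) ∈ F` and `H¹(E) ∈ T`,
where `T` and `F` are full subcategories of the heart. -/
def tiltedHeart (T F : ObjectProperty (HeartCat t)) : ObjectProperty D := fun E =>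
  (∀ i : ℤ, i ≠ 0 → i ≠ 1 → IsZero (cohomology t i E)) ∧
    F.map t.heart.ι (cohomology t 0 E) ∧ T.map t.heart.ι (cohomology t 1 E)

/-- `t'` is the bounded t-structure obtained from `t` by left tilting with respect to the
torsion pair `(T, F)` in the heart of `t`. -/
def IsLeftTilt (T F : ObjectProperty (HeartCat t)) (t' : TStructure D) : Prop :=
  IsTorsionPair T F ∧ IsBounded t' ∧ t'.heart = tiltedHeart t T F

/-- `t'` is obtained from `t`, whose heart is algebraic, by the simple left tilt at some
simple object `S` of the heart of `t`. -/
def IsSimpleLeftTilt (t t' : TStructure D) : Prop :=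
  IsAlgebraicHeart t ∧ ∃ S : HeartCat t, Simple S ∧
    IsLeftTilt t (extClosure S) (homOrthogonal S) t'

/-- The (algebraic) heart of `t` can be tilted indefinitely: every heart obtained from it by a
finite sequence of simple tilts is algebraic, with the same number of simple objects. -/
def CanTiltIndefinitely : Prop :=
  ∀ t' : TStructure D, Relation.ReflTransGen IsSimpleLeftTilt t t' →
    IsAlgebraicHeart t' ∧
      (simpleClasses (HeartCat t')).ncard = (simpleClasses (HeartCat t)).ncard

/-- The torsion classes in the heart of `t`, ordered by inclusion. -/
abbrev TorsionClass : Type u :=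
  {T : ObjectProperty (HeartCat t) // IsTorsionClass T}

/-- The arrows of the Hasse quiver of the poset of torsion classes: there is an arrow
`T₁ ⟶ T₂` if `T₂ < T₁` with no torsion class strictly in between. -/
def HasseArrow (T₁ T₂ : TorsionClass t) : Prop := T₂ ⋖ T₁

/-- The intermediate t-structures: the bounded t-structures `t'` whose aisle lies between the
aisle `D^{≤ 0}` of `t` and its shift `D^{≤ 0}[-1] = D^{≤ 1}`. -/
structure IntermediateTStructure where
  /-- the underlying t-structure -/
  str : TStructure D
  bounded : IsBounded str
  le_str : t.le 0 ≤ str.le 0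
  str_le : str.le 0 ≤ t.le 1

/-- Intermediate t-structures are ordered by inclusion of aisles. -/
instance : LE (IntermediateTStructure t) := ⟨fun C₁ C₂ => C₁.str.le 0 ≤ C₂.str.le 0⟩

/-- The arrows of the exchange quiver: there is an arrow `C₁ ⟶ C₂` if `C₂` is obtained from
`C₁` by a simple left tilt. -/
def ExchangeArrow (C₁ C₂ : IntermediateTStructure t) : Prop :=
  IsSimpleLeftTilt C₁.str C₂.str

/-- The set of Grothendieck classes of endo-trivial objects of the heart of `t`. -/
def endoTrivialClasses : Set (GrothendieckGroup D) :=
  {c | ∃ E : HeartCat t, IsEndoTrivial E ∧ grothendieckClass E.obj = c}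

end Triangulated

end HeartTilting

end

/-!
The idea is to climb from one intermediate t-structure to another by simple tilts.

A torsion class `T` in the heart `A` of `t` gives the aisle of the extensions of objects of `T[-1]`
by objects of `D^{≤ 0}`; conversely an intermediate aisle `C'` gives the torsion class of the
objects `X` of `A` with `X[-1]` in `C'`. These constructions are mutually inverse and monotone
(`torsionClassOrderIso`), and the tilt is the only bounded t-structure with the prescribed heart
because a bounded t-structure is determined by its heart (`tStructure_ext_of_heart`). This
applies to the heart of every bounded t-structure, not only to that of `t`.

If `s ⊊ s'` are intermediate and the heart of `s` is algebraic, then `s'` corresponds to a nonzero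
torsion class in the heart of `s`. Being closed under quotients, this class contains a simple
object `S`, and the simple tilt of `s` at `S` still lies below `s'`
(`exists_isSimpleLeftTilt`). Repeating the step starting from `t` gives a strictly increasing chain
below `s'`. The chain is finite: this is clear when there are finitely many torsion classes;
otherwise one uses the classes in `K(D)` of the endo-trivial objects in the torsion class of `s`.
Since `S[-1]` lies in `D^{≤ 1}`, the object `S` lies in `A`, and by Schur's lemma it is endo-trivial
and becomes torsion after the tilt. Its class is new: an endo-trivial object `E` that was torsion
before has `E[-1]` in the heart of `s`, hence has negative Euler characteristic (the alternating
sum of the lengths of the cohomology objects for `s`), while that of `S` is positive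
(`endoTrivialTorsionClasses_ssubset`). So every intermediate t-structure is reached by simple tilts
(`reflTransGen_of_intermediate`), and its heart is algebraic because `A` can be tilted
indefinitely.

A covering relation `T₂ ⋖ T₁` is then a simple tilt, by one such step upwards from the tilt at `T₂`
towards the tilt at `T₁` (`isSimpleLeftTilt_of_covBy`). Conversely, what lies strictly above `s`
and below its simple tilt at `S` corresponds to a nonzero torsion class contained in `⟨S⟩`; it
contains a simple object, which must be `S` (`covBy_of_isSimpleLeftTilt`).
-/

noncomputable section

set_option linter.unusedSectionVars false

namespace HeartTilting

section Heart

variable {D : Type u} [Category.{v} D] [Preadditive D] [HasZeroObject D] [HasShift D ℤ]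
  [∀ n : ℤ, (shiftFunctor D n).Additive] [Pretriangulated D]

/-! ### Objects fitting into distinguished triangles -/

/-- There is a distinguished triangle `X ⟶ E ⟶ Y ⟶ X⟦1⟧`, i.e. `E` is an extension of `Y`
by `X`. -/
def IsExtension (X E Y : D) : Prop :=
  ∃ (f : X ⟶ E) (g : E ⟶ Y) (h : Y ⟶ X⟦(1 : ℤ)⟧), Triangle.mk f g h ∈ distTriang D

namespace IsExtension

variable {X E Y X' E' Y' : D}

lemma of_triangle (T : Triangle D) (hT : T ∈ distTriang D) :
    IsExtension T.obj₁ T.obj₂ T.obj₃ := ⟨T.mor₁, T.mor₂, T.mor₃, hT⟩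

lemma rotate (h : IsExtension X E Y) : IsExtension E Y (X⟦(1 : ℤ)⟧) := by
  obtain ⟨f, g, k, hT⟩ := h
  exact of_triangle _ (rot_of_distTriang _ hT)

lemma invRotate (h : IsExtension X E Y) : IsExtension (Y⟦(-1 : ℤ)⟧) X E := by
  obtain ⟨f, g, k, hT⟩ := h
  exact of_triangle _ (inv_rot_of_distTriang _ hT)

lemma shift (h : IsExtension X E Y) (n : ℤ) : IsExtension (X⟦n⟧) (E⟦n⟧) (Y⟦n⟧) := by
  obtain ⟨f, g, k, hT⟩ := h
  exact of_triangle _ (Triangle.shift_distinguished _ hT n)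

lemma congr (h : IsExtension X E Y) (e₁ : X ≅ X') (e₂ : E ≅ E') (e₃ : Y ≅ Y') :
    IsExtension X' E' Y' := by
  obtain ⟨f, g, k, hT⟩ := h
  refine ⟨e₁.inv ≫ f ≫ e₂.hom, e₂.inv ≫ g ≫ e₃.hom, e₃.inv ≫ k ≫ e₁.hom⟦1⟧', ?_⟩
  refine isomorphic_distinguished _ hT _ (Triangle.isoMk _ _ e₁.symm e₂.symm e₃.symm ?_ ?_ ?_)
  · change (e₁.inv ≫ f ≫ e₂.hom) ≫ e₂.inv = e₁.inv ≫ f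
    simp
  · change (e₂.inv ≫ g ≫ e₃.hom) ≫ e₃.inv = e₂.inv ≫ g
    simp
  · change (e₃.inv ≫ k ≫ e₁.hom⟦1⟧') ≫ e₁.inv⟦1⟧' = e₃.inv ≫ k
    simp [← Functor.map_comp]

lemma of_isZero_right (e : X ≅ E) (hY : IsZero Y) : IsExtension X E Y :=
  (of_triangle _ (contractible_distinguished X)).congr (Iso.refl _) e
    ((isZero_zero D).iso hY)

lemma of_isZero_left (hX : IsZero X) (e : E ≅ Y) : IsExtension X E Y :=
  (of_triangle _ (contractible_distinguished₁ Y)).congr ((isZero_zero D).iso hX) e.symm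
    (Iso.refl _)

lemma biprod (X Y : D) : IsExtension X (X ⊞ Y) Y :=
  of_triangle _ (binaryBiproductTriangle_distinguished X Y)

lemma nonempty_iso_of_isZero_left (h : IsExtension X E Y) (hX : IsZero X) : Nonempty (E ≅ Y) := by
  obtain ⟨f, g, k, hT⟩ := h
  have : IsIso g := (Triangle.isZero₁_iff_isIso₂ _ hT).1 hX
  exact ⟨asIso g⟩

lemma nonempty_iso_of_isZero_right (h : IsExtension X E Y) (hY : IsZero Y) :
    Nonempty (X ≅ E) := by
  obtain ⟨f, g, k, hT⟩ := h
  have : IsIso f := (Triangle.isZero₃_iff_isIso₁ _ hT).1 hY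
  exact ⟨asIso f⟩

lemma assoc_left [IsTriangulated D] {A B C X E : D}
    (h₁ : IsExtension A X B) (h₂ : IsExtension X E C) :
    ∃ W, IsExtension A E W ∧ IsExtension B W C := by
  obtain ⟨f, g, h, hT⟩ := h₂
  obtain ⟨f', g', h', hT'⟩ := h₁
  obtain ⟨W, g'', h'', hT''⟩ := distinguished_cocone_triangle (f' ≫ f)
  exact ⟨W, ⟨_, _, _, hT''⟩, ⟨_, _, _, (someOctahedron rfl hT' hT hT'').mem⟩⟩

lemma assoc_right [IsTriangulated D] {A B C W E : D}
    (h₁ : IsExtension A E W) (h₂ : IsExtension B W C) :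
    ∃ X, IsExtension A X B ∧ IsExtension X E C := by
  obtain ⟨f, g, h, hT⟩ := h₁
  obtain ⟨f', g', h', hT'⟩ := h₂
  obtain ⟨X, f'', h'', hT''⟩ := distinguished_cocone_triangle₁ (g ≫ g')
  exact ⟨X, ⟨_, _, _, (someOctahedron' rfl hT hT' hT'').mem⟩, ⟨_, _, _, hT''⟩⟩

variable (t : TStructure D)

lemma le₂ {n : ℤ} (h : IsExtension X E Y) (hX : t.le n X) (hY : t.le n Y) : t.le n E := by
  obtain ⟨f, g, k, hT⟩ := h
  exact (t.isLE₂ _ hT n ⟨hX⟩ ⟨hY⟩).le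

lemma ge₂ {n : ℤ} (h : IsExtension X E Y) (hX : t.ge n X) (hY : t.ge n Y) : t.ge n E := by
  obtain ⟨f, g, k, hT⟩ := h
  exact (t.isGE₂ _ hT n ⟨hX⟩ ⟨hY⟩).ge

end IsExtension

variable (t : TStructure D)

lemma le_shift_iff {X : D} (n a n' : ℤ) (h : a + n' = n) : t.le n' (X⟦a⟧) ↔ t.le n X := by
  simpa only [t.le_iff_isLE] using t.isLE_shift_iff X n a n' h

lemma ge_shift_iff {X : D} (n a n' : ℤ) (h : a + n' = n) : t.ge n' (X⟦a⟧) ↔ t.ge n X := by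
  simpa only [t.ge_iff_isGE] using t.isGE_shift_iff X n a n' h

lemma le_of_isZero {X : D} (hX : IsZero X) (n : ℤ) : t.le n X := (t.isLE_of_isZero hX n).le

lemma ge_of_isZero {X : D} (hX : IsZero X) (n : ℤ) : t.ge n X := (t.isGE_of_isZero hX n).ge

lemma hom_eq_zero {X Y : D} (f : X ⟶ Y) {m n : ℤ} (hX : t.le m X) (hY : t.ge n Y)
    (h : m < n) : f = 0 :=
  t.zero_of_isLE_of_isGE f m n h ⟨hX⟩ ⟨hY⟩

lemma isZero_of_le_of_ge {X : D} {m n : ℤ} (hX : t.le m X) (hY : t.ge n X) (h : m < n) :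
    IsZero X := by
  rw [IsZero.iff_id_eq_zero]
  exact hom_eq_zero t _ hX hY h

lemma ge_iff_orthogonal {X : D} {m n : ℤ} (h : m + 1 = n) :
    t.ge n X ↔ ∀ (Y : D) (f : Y ⟶ X), t.le m Y → f = 0 := by
  rw [t.ge_iff_isGE, t.isGE_iff_orthogonal m n h]
  simp only [t.le_iff_isLE]

lemma exists_isExtension (X : D) {m n : ℤ} (h : m + 1 = n) :
    ∃ P Q, t.le m P ∧ t.ge n Q ∧ IsExtension P X Q := by
  obtain ⟨P, Q, hP, hQ, f, g, k, hT⟩ := t.exists_triangle X m n h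
  exact ⟨P, Q, hP, hQ, f, g, k, hT⟩

lemma exists_le_ge (hb : IsBounded t) (X : D) : ∃ a b : ℤ, t.le b X ∧ t.ge a X := by
  have hX : t.bounded X := by rw [hb]; trivial
  obtain ⟨⟨a, ha⟩, ⟨b, hb⟩⟩ := hX
  exact ⟨a, b, hb.le, ha.ge⟩

/-- A t-structure is determined by its aisle. -/
lemma tStructure_ext {t t' : TStructure D} (h : t.le 0 = t'.le 0) : t = t' := by
  have hle : t.le = t'.le := by
    funext n
    ext X
    rw [← le_shift_iff t n n 0 (by simp), h, le_shift_iff t' n n 0 (by simp)]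
  have hge : t.ge = t'.ge := by
    funext n
    ext X
    rw [ge_iff_orthogonal t (sub_add_cancel n 1), ge_iff_orthogonal t' (sub_add_cancel n 1), hle]
  cases t; cases t'; cases hle; cases hge; rfl

/-- Passing to a larger aisle makes the coaisle smaller. -/
lemma ge_le_ge_of_le {t t' : TStructure D} (h : t.le 0 ≤ t'.le 0) (n : ℤ) : t'.ge n ≤ t.ge n := by
  intro X hX
  rw [ge_iff_orthogonal t (sub_add_cancel n 1)]
  intro Y f hY
  refine hom_eq_zero t' f (m := n - 1) ?_ hX (by lia)
  rw [← le_shift_iff t' (n - 1) (n - 1) 0 (by lia)]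
  exact h _ ((le_shift_iff t (n - 1) (n - 1) 0 (by lia)).2 hY)

lemma le_le_le_of_le {t t' : TStructure D} (h : t.le 0 ≤ t'.le 0) (n : ℤ) : t.le n ≤ t'.le n := by
  intro X hX
  rw [← le_shift_iff t' n n 0 (by lia)]
  exact h _ ((le_shift_iff t n n 0 (by lia)).2 hX)

/-! ### The abelian structure of the heart -/

instance : t.heart.ContainsZero where
  exists_zero := ⟨_, isZero_zero D, le_of_isZero t (isZero_zero D) 0,
    ge_of_isZero t (isZero_zero D) 0⟩

lemma IsExtension.heart₂ {X E Y : D} (h : IsExtension X E Y) (hX : t.heart X) (hY : t.heart Y) :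
    t.heart E :=
  ⟨h.le₂ t hX.1 hY.1, h.ge₂ t hX.2 hY.2⟩

instance : t.heart.IsClosedUnderBinaryProducts where
  limitsOfShape_le := by
    rintro X ⟨p⟩
    have h₁ := p.prop_diag_obj ⟨.left⟩
    have h₂ := p.prop_diag_obj ⟨.right⟩
    have hX := (IsExtension.biprod (p.diag.obj ⟨.left⟩) (p.diag.obj ⟨.right⟩)).heart₂ t h₁ h₂
    have e := (biprod.isoProd (p.diag.obj ⟨.left⟩) (p.diag.obj ⟨.right⟩))
    refine t.heart.prop_of_iso ?_ hX
    refine e ≪≫ HasLimit.isoOfNatIso (diagramIsoPair p.diag).symm ≪≫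
      (limit.isLimit p.diag).conePointUniqueUpToIso p.isLimit

instance : t.heart.IsClosedUnderFiniteProducts := .mk'

lemma heart_hom_shift_eq_zero ⦃X Y : HeartCat t⦄ ⦃n : ℤ⦄
    (f : t.heart.ι.obj X ⟶ (t.heart.ι.obj Y)⟦n⟧) (hn : n < 0) : f = 0 :=
  hom_eq_zero t f X.2.1 ((ge_shift_iff t 0 n (-n) (by lia)).2 Y.2.2) (by lia)

lemma admissibleMorphism_heart [IsTriangulated D] :
    AbelianSubcategory.admissibleMorphism t.heart.ι = ⊤ := by
  rw [eq_top_iff]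
  intro X Y f _ C f₂ f₃ hT
  have hC := (IsExtension.of_triangle _ hT).rotate
  have hC' : t.le 0 C := hC.le₂ t Y.2.1
    ((le_shift_iff t 0 1 (-1) (by lia)).2 X.2.1 |> t.le_monotone (by lia) _)
  have hC'' : t.ge (-1) C := hC.ge₂ t (t.ge_antitone (show (-1 : ℤ) ≤ 0 by lia) _ Y.2.2)
    ((ge_shift_iff t 0 1 (-1) (by lia)).2 X.2.2)
  obtain ⟨P, Q, hP, hQ, a, b, c, hT'⟩ := t.exists_triangle C (-1) 0 (by lia)
  have hPQ : IsExtension P C Q := ⟨a, b, c, hT'⟩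
  have hQ' : t.le 0 Q := hPQ.rotate.le₂ t hC'
    (t.le_monotone (show (-2 : ℤ) ≤ 0 by lia) _ ((le_shift_iff t (-1) 1 (-2) (by lia)).2 hP))
  have hP' : t.ge (-1) P := hPQ.invRotate.ge₂ t
    (t.ge_antitone (show (-1 : ℤ) ≤ 1 by lia) _ ((ge_shift_iff t 0 (-1) 1 (by lia)).2 hQ)) hC''
  obtain ⟨a', b', c', hT''⟩ := hPQ.congr (shiftNegShift P (1 : ℤ)).symm (Iso.refl _) (Iso.refl _)
  exact ⟨⟨P⟦(-1 : ℤ)⟧, (le_shift_iff t (-1) (-1) 0 (by lia)).2 hP,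
    (ge_shift_iff t (-1) (-1) 0 (by lia)).2 hP'⟩, ⟨Q, hQ', hQ⟩, a', b', c', hT''⟩

instance [IsTriangulated D] : Abelian (HeartCat t) :=
  AbelianSubcategory.abelian t.heart.ι (heart_hom_shift_eq_zero t) (admissibleMorphism_heart t)

end Heart

section Bridge

variable {D : Type u} [Category.{v} D] [Preadditive D] [HasZeroObject D] [HasShift D ℤ]
  [∀ n : ℤ, (shiftFunctor D n).Additive] [Pretriangulated D] [IsTriangulated D]
  (t : TStructure D)

/-! ### Short exact sequences in the heart -/

lemma shortExact_of_distTriang {X E Y : HeartCat t} (f : X ⟶ E) (g : E ⟶ Y)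
    (h : t.heart.ι.obj Y ⟶ (t.heart.ι.obj X)⟦(1 : ℤ)⟧)
    (hT : Triangle.mk (t.heart.ι.map f) (t.heart.ι.map g) h ∈ distTriang D) :
    ∃ w : f ≫ g = 0, (ShortComplex.mk f g w).ShortExact := by
  have hk := AbelianSubcategory.isLimitKernelForkOfDistTriang (heart_hom_shift_eq_zero t) f g h hT
  have hc := AbelianSubcategory.isColimitCokernelCoforkOfDistTriang (heart_hom_shift_eq_zero t)
    f g h hT
  have w : f ≫ g = 0 := t.heart.ι.map_injective (by
    rw [Functor.map_comp, Functor.map_zero]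
    exact comp_distTriang_mor_zero₁₂ _ hT)
  exact ⟨w, { exact := ShortComplex.exact_of_f_is_kernel _ hk
              mono_f := mono_of_isLimit_fork hk
              epi_g := epi_of_isColimit_cofork hc }⟩

lemma shortExact_of_isExtension {X E Y : HeartCat t} (h : IsExtension X.obj E.obj Y.obj) :
    ∃ (f : X ⟶ E) (g : E ⟶ Y) (w : f ≫ g = 0), (ShortComplex.mk f g w).ShortExact := by
  obtain ⟨f, g, k, hT⟩ := h
  exact ⟨ObjectProperty.homMk f, ObjectProperty.homMk g,
    shortExact_of_distTriang t (ObjectProperty.homMk f) (ObjectProperty.homMk g) k hT⟩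

lemma exists_distTriang_of_shortExact {S : ShortComplex (HeartCat t)} (hS : S.ShortExact) :
    ∃ h : S.X₃.obj ⟶ S.X₁.obj⟦(1 : ℤ)⟧, Triangle.mk S.f.hom S.g.hom h ∈ distTriang D := by
  have := hS.epi_g
  obtain ⟨K, i, δ, hT⟩ := AbelianSubcategory.exists_distinguished_triangle_of_epi
    (heart_hom_shift_eq_zero t) (admissibleMorphism_heart t) S.g
  have hk := AbelianSubcategory.isLimitKernelForkOfDistTriang (heart_hom_shift_eq_zero t) i S.g δ hT
  let e := hk.conePointUniqueUpToIso hS.fIsKernel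
  have he : e.inv ≫ i = S.f :=
    hk.conePointUniqueUpToIso_inv_comp hS.fIsKernel WalkingParallelPair.zero
  have he' : S.f.hom = (t.heart.ι.mapIso e).inv ≫ t.heart.ι.map i :=
    (congrArg (fun f => f.hom) he).symm
  refine ⟨δ ≫ (t.heart.ι.mapIso e).hom⟦1⟧', isomorphic_distinguished _ hT _
    (Triangle.isoMk _ _ (t.heart.ι.mapIso e).symm (Iso.refl _) (Iso.refl _) ?_ ?_ ?_)⟩
  · change S.f.hom ≫ 𝟙 S.X₂.obj = (t.heart.ι.mapIso e).inv ≫ t.heart.ι.map i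
    rw [Category.comp_id, he']
  · change S.g.hom ≫ 𝟙 S.X₃.obj = 𝟙 S.X₂.obj ≫ S.g.hom
    simp
  · change (δ ≫ (t.heart.ι.mapIso e).hom⟦1⟧') ≫ (t.heart.ι.mapIso e).inv⟦1⟧' = 𝟙 _ ≫ δ
    rw [Category.assoc, ← Functor.map_comp, Iso.hom_inv_id, CategoryTheory.Functor.map_id]
    simp

lemma isExtension_of_shortExact {S : ShortComplex (HeartCat t)} (hS : S.ShortExact) :
    IsExtension S.X₁.obj S.X₂.obj S.X₃.obj := by
  obtain ⟨h, hT⟩ := exists_distTriang_of_shortExact t hS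
  exact ⟨_, _, h, hT⟩

lemma gabrielProduct_iff {P Q : ObjectProperty (HeartCat t)} {E : HeartCat t} :
    gabrielProduct P Q E ↔
      ∃ X Y : HeartCat t, P X ∧ Q Y ∧ IsExtension X.obj E.obj Y.obj := by
  constructor
  · rintro ⟨X, Y, f, g, w, hX, hY, h⟩
    exact ⟨X, Y, hX, hY, isExtension_of_shortExact t h⟩
  · rintro ⟨X, Y, hX, hY, h⟩
    obtain ⟨f, g, w, h⟩ := shortExact_of_isExtension t h
    exact ⟨X, Y, f, g, w, hX, hY, h⟩

lemma isZero_iff_isZero_obj {X : HeartCat t} : IsZero X ↔ IsZero X.obj := by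
  rw [IsZero.iff_id_eq_zero, IsZero.iff_id_eq_zero]
  constructor
  · intro h
    exact congrArg (fun f => t.heart.ι.map f) h |>.trans (t.heart.ι.map_zero _ _)
  · intro h
    exact t.heart.ι.map_injective (h.trans (t.heart.ι.map_zero _ _).symm)

/-! ### Torsion pairs in the heart -/

/-- A full subcategory of the heart, regarded as a full subcategory of the triangulated
category. -/
def ambient (T : ObjectProperty (HeartCat t)) : ObjectProperty D :=
  fun X => ∃ h : t.heart X, T ⟨X, h⟩

lemma ambient_obj {T : ObjectProperty (HeartCat t)} {X : HeartCat t} :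
    ambient t T X.obj ↔ T X := ⟨fun ⟨_, h⟩ => h, fun h => ⟨X.2, h⟩⟩

lemma ambient_le {T T' : ObjectProperty (HeartCat t)} (h : T ≤ T') :
    ambient t T ≤ ambient t T' := fun _ hX => ⟨hX.1, h _ hX.2⟩

/-- The isomorphism in the heart given by an isomorphism of the underlying objects. -/
abbrev heartIso {X Y : HeartCat t} (e : X.obj ≅ Y.obj) : X ≅ Y := t.heart.ι.preimageIso e

lemma map_ι_iff_ambient {T : ObjectProperty (HeartCat t)} [T.IsClosedUnderIsomorphisms] {X : D} :
    T.map t.heart.ι X ↔ ambient t T X := by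
  constructor
  · rintro ⟨Y, hY, ⟨e⟩⟩
    have hX := t.heart.prop_of_iso e Y.2
    exact ⟨hX, T.prop_of_iso (heartIso t (Y := ⟨X, hX⟩) e) hY⟩
  · rintro ⟨hX, h⟩
    exact ⟨⟨X, hX⟩, h, ⟨Iso.refl _⟩⟩

/-- Torsion pairs in the heart of `t`, phrased with full subcategories of the triangulated
category and distinguished triangles in place of short exact sequences. -/
structure IsHeartTorsionPair (T F : ObjectProperty D) : Prop where
  torsion_le : T ≤ t.heart
  torsionFree_le : F ≤ t.heart
  torsion_iso : T.IsClosedUnderIsomorphisms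
  torsionFree_iso : F.IsClosedUnderIsomorphisms
  hom_eq_zero : ∀ ⦃X Y : D⦄ (f : X ⟶ Y), T X → F Y → f = 0
  exists_isExtension : ∀ E : D, t.heart E → ∃ X Y, T X ∧ F Y ∧ IsExtension X E Y

variable {t}

lemma IsTorsionPair.ambient {T F : ObjectProperty (HeartCat t)} (h : IsTorsionPair T F) :
    IsHeartTorsionPair t (ambient t T) (ambient t F) where
  torsion_le _ hX := hX.1
  torsionFree_le _ hX := hX.1
  torsion_iso := ⟨fun {X Y} e hX => by
    have := h.closedUnderIso_torsion
    have hY := t.heart.prop_of_iso e hX.1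
    exact ⟨hY, T.prop_of_iso (heartIso t (X := ⟨X, hX.1⟩) (Y := ⟨Y, hY⟩) e) hX.2⟩⟩
  torsionFree_iso := ⟨fun {X Y} e hX => by
    have := h.closedUnderIso_torsionFree
    have hY := t.heart.prop_of_iso e hX.1
    exact ⟨hY, F.prop_of_iso (heartIso t (X := ⟨X, hX.1⟩) (Y := ⟨Y, hY⟩) e) hX.2⟩⟩
  hom_eq_zero X Y f hX hY := by
    obtain ⟨hX, hTX⟩ := hX
    obtain ⟨hY, hFY⟩ := hY
    have := h.hom_eq_zero (X := ⟨X, hX⟩) (Y := ⟨Y, hY⟩) (ObjectProperty.homMk f) hTX hFY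
    exact congrArg (fun f => f.hom) this
  exists_isExtension E hE := by
    obtain ⟨X, Y, hX, hY, hXY⟩ := (gabrielProduct_iff t).1 (h.exists_shortExact ⟨E, hE⟩)
    exact ⟨X.obj, Y.obj, (ambient_obj t).2 hX, (ambient_obj t).2 hY, hXY⟩

namespace IsHeartTorsionPair

variable {T F : ObjectProperty D} (h : IsHeartTorsionPair t T F)

include h

lemma isTorsionPair : IsTorsionPair (T.inverseImage t.heart.ι) (F.inverseImage t.heart.ι) := by
  have := h.torsion_iso
  have := h.torsionFree_iso
  refine ⟨inferInstance, inferInstance, ?_, ?_⟩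
  · intro X Y f hX hY
    exact t.heart.ι.map_injective ((h.hom_eq_zero _ hX hY).trans (t.heart.ι.map_zero _ _).symm)
  · intro E
    rw [gabrielProduct_iff]
    obtain ⟨X, Y, hX, hY, hXY⟩ := h.exists_isExtension E.obj E.2
    exact ⟨⟨X, h.torsion_le _ hX⟩, ⟨Y, h.torsionFree_le _ hY⟩, hX, hY, hXY⟩

lemma torsion_iff {X : D} :
    T X ↔ t.heart X ∧ ∀ (Y : D) (f : X ⟶ Y), F Y → f = 0 := by
  refine ⟨fun hX => ⟨h.torsion_le _ hX, fun Y f hY => h.hom_eq_zero f hX hY⟩, ?_⟩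
  rintro ⟨hX, hF⟩
  obtain ⟨P, Q, hP, hQ, f, g, k, hT⟩ := h.exists_isExtension X hX
  have hQ0 : IsZero Q := by
    rw [IsZero.iff_id_eq_zero]
    obtain ⟨r, hr⟩ := Triangle.yoneda_exact₃ _ hT (𝟙 Q)
      (by change g ≫ 𝟙 Q = 0; rw [hF _ g hQ, zero_comp])
    have hr0 : r = 0 := HeartTilting.hom_eq_zero t r
      ((le_shift_iff t 0 1 (-1) (by lia)).2 (h.torsion_le _ hP).1) (h.torsionFree_le _ hQ).2
      (by lia)
    rw [hr, hr0]
    exact comp_zero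
  obtain ⟨e⟩ := IsExtension.nonempty_iso_of_isZero_right ⟨f, g, k, hT⟩ hQ0
  have := h.torsion_iso
  exact T.prop_of_iso e hP

lemma torsionFree_iff {Y : D} :
    F Y ↔ t.heart Y ∧ ∀ (X : D) (f : X ⟶ Y), T X → f = 0 := by
  refine ⟨fun hY => ⟨h.torsionFree_le _ hY, fun X f hX => h.hom_eq_zero f hX hY⟩, ?_⟩
  rintro ⟨hY, hT'⟩
  obtain ⟨P, Q, hP, hQ, f, g, k, hT⟩ := h.exists_isExtension Y hY
  have hP0 : IsZero P := by
    rw [IsZero.iff_id_eq_zero]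
    obtain ⟨r, hr⟩ := Triangle.coyoneda_exact₂ _ (inv_rot_of_distTriang _ hT) (𝟙 P)
      (by change 𝟙 P ≫ f = 0; rw [hT' _ f hP, comp_zero])
    have hr0 : r = 0 := HeartTilting.hom_eq_zero t r (h.torsion_le _ hP).1
      ((ge_shift_iff t 0 (-1) 1 (by lia)).2 (h.torsionFree_le _ hQ).2) (by lia)
    rw [hr, hr0]
    exact zero_comp
  obtain ⟨e⟩ := IsExtension.nonempty_iso_of_isZero_left ⟨f, g, k, hT⟩ hP0
  have := h.torsionFree_iso
  exact F.prop_of_iso e.symm hQ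

lemma torsion_of_isZero {X : D} (hX : IsZero X) : T X :=
  h.torsion_iff.2 ⟨⟨le_of_isZero t hX 0, ge_of_isZero t hX 0⟩, fun _ _ _ => hX.eq_of_src _ _⟩

lemma torsionFree_of_isZero {X : D} (hX : IsZero X) : F X :=
  h.torsionFree_iff.2 ⟨⟨le_of_isZero t hX 0, ge_of_isZero t hX 0⟩, fun _ _ _ => hX.eq_of_tgt _ _⟩

end IsHeartTorsionPair

end Bridge

section Cohomology

variable {D : Type u} [Category.{v} D] [Preadditive D] [HasZeroObject D] [HasShift D ℤ]
  [∀ n : ℤ, (shiftFunctor D n).Additive] [Pretriangulated D] [IsTriangulated D]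
  (t : TStructure D)

/-! ### Cohomology objects -/

/-- The isomorphism of cohomology objects induced by an isomorphism. -/
def cohomologyIso (i : ℤ) {X Y : D} (e : X ≅ Y) : cohomology t i X ≅ cohomology t i Y :=
  (shiftFunctor D i).mapIso ((t.truncGELE i i).mapIso e)

lemma nonempty_cohomology_iso_left {P E Q : D} (h : IsExtension P E Q) (i : ℤ)
    (hQ : t.ge (i + 1) Q) : Nonempty (cohomology t i E ≅ cohomology t i P) := by
  obtain ⟨f, g, k, hT⟩ := h
  have : IsIso ((t.truncLE i).map f) :=
    t.isIso₁_truncLE_map_of_isGE (Triangle.mk f g k) hT i (i + 1) rfl ⟨hQ⟩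
  exact ⟨(shiftFunctor D i).mapIso
    ((t.truncGE i).mapIso (asIso ((t.truncLE i).map f)).symm)⟩

lemma nonempty_cohomology_iso_right {P E Q : D} (h : IsExtension P E Q) (i : ℤ)
    (hP : t.le (i - 1) P) : Nonempty (cohomology t i E ≅ cohomology t i Q) := by
  obtain ⟨f, g, k, hT⟩ := h
  have : IsIso ((t.truncGE i).map g) :=
    t.isIso₂_truncGE_map_of_isLE (Triangle.mk f g k) hT (i - 1) i (by lia) ⟨hP⟩
  exact ⟨(shiftFunctor D i).mapIso ((t.truncGELEIsoLEGE i i).app E ≪≫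
    (t.truncLE i).mapIso (asIso ((t.truncGE i).map g)) ≪≫ ((t.truncGELEIsoLEGE i i).app Q).symm)⟩

lemma nonempty_cohomology_iso_shift {X : D} {i : ℤ} (h₁ : t.le i X) (h₂ : t.ge i X) :
    Nonempty (cohomology t i X ≅ X⟦i⟧) := by
  have : t.IsLE X i := ⟨h₁⟩
  have : t.IsGE X i := ⟨h₂⟩
  exact ⟨(shiftFunctor D i).mapIso ((asIso ((t.truncGEπ i).app ((t.truncLE i).obj X))).symm ≪≫
    asIso ((t.truncLEι i).app X))⟩

lemma isZero_shift_iff {X : D} (n : ℤ) : IsZero (X⟦n⟧) ↔ IsZero X := by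
  constructor
  · intro h
    exact ((shiftFunctor D (-n)).map_isZero h).of_iso (shiftShiftNeg X n).symm
  · exact fun h => (shiftFunctor D n).map_isZero h

lemma isZero_cohomology_of_ge {X : D} {i n : ℤ} (hX : t.ge n X) (h : i < n) :
    IsZero (cohomology t i X) := by
  rw [cohomology, isZero_shift_iff]
  have : t.IsGE X (i + 1) := ⟨t.ge_antitone (by lia) _ hX⟩
  exact (t.truncGE i).map_isZero (t.isZero_truncLE_obj_of_isGE i (i + 1) rfl X)

lemma isZero_cohomology_of_le {X : D} {i n : ℤ} (hX : t.le n X) (h : n < i) :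
    IsZero (cohomology t i X) := by
  rw [cohomology, isZero_shift_iff]
  have : t.IsLE X (i - 1) := ⟨t.le_monotone (by lia) _ hX⟩
  refine IsZero.of_iso ?_ ((t.truncGELEIsoLEGE i i).app X)
  exact (t.truncLE i).map_isZero (t.isZero_truncGE_obj_of_isLE (i - 1) i (by lia) X)

lemma le_sub_one_of_isZero_cohomology {X : D} {n : ℤ} (hX : t.le n X)
    (h : IsZero (cohomology t n X)) : t.le (n - 1) X := by
  rw [cohomology, isZero_shift_iff] at h
  have : t.IsLE X n := ⟨hX⟩
  rw [t.le_iff_isLE, t.isLE_iff_isZero_truncGE_obj (n - 1) n (by lia)]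
  exact h.of_iso ((t.truncGE n).mapIso (asIso ((t.truncLEι n).app X)).symm)

lemma ge_add_one_of_isZero_cohomology {X : D} {n : ℤ} (hX : t.ge n X)
    (h : IsZero (cohomology t n X)) : t.ge (n + 1) X := by
  rw [cohomology, isZero_shift_iff] at h
  have : t.IsGE X n := ⟨hX⟩
  rw [t.ge_iff_isGE, t.isGE_iff_isZero_truncLE_obj n (n + 1) rfl]
  exact h.of_iso (asIso ((t.truncGEπ n).app ((t.truncLE n).obj X)))

lemma le_of_isZero_cohomology (hb : IsBounded t) {X : D} (n : ℤ)
    (h : ∀ i, n < i → IsZero (cohomology t i X)) : t.le n X := by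
  obtain ⟨_, b, hX, _⟩ := exists_le_ge t hb X
  have key : ∀ k : ℕ, t.le (n + k) X → t.le n X := by
    intro k
    induction k with
    | zero => simp
    | succ k ih =>
      intro hk
      refine ih ?_
      have := le_sub_one_of_isZero_cohomology t hk (h _ (by lia))
      exact t.le_monotone (by lia) _ this
  exact key (b - n).toNat (t.le_monotone (by lia) _ hX)

lemma ge_of_isZero_cohomology (hb : IsBounded t) {X : D} (n : ℤ)
    (h : ∀ i, i < n → IsZero (cohomology t i X)) : t.ge n X := by
  obtain ⟨a, _, _, hX⟩ := exists_le_ge t hb X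
  have key : ∀ k : ℕ, t.ge (n - k) X → t.ge n X := by
    intro k
    induction k with
    | zero => simp
    | succ k ih =>
      intro hk
      refine ih ?_
      have := ge_add_one_of_isZero_cohomology t hk (h _ (by lia))
      exact t.ge_antitone (by lia) _ this
  exact key (n - a).toNat (t.ge_antitone (by lia) _ hX)

end Cohomology

section Tilt

variable {D : Type u} [Category.{v} D] [Preadditive D] [HasZeroObject D] [HasShift D ℤ]
  [∀ n : ℤ, (shiftFunctor D n).Additive] [Pretriangulated D] [IsTriangulated D]
  {t : TStructure D}

/-! ### The left tilt with respect to a torsion pair -/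

variable (t) in
/-- The aisle of the left tilt: the objects `E` in `D^{≤ 1}` with `H¹(E)` torsion, described as
the extensions of an object of `T[-1]` by an object of `D^{≤ 0}`. -/
def tiltAisle (T : ObjectProperty D) : ObjectProperty D := fun E =>
  ∃ P Q, t.le 0 P ∧ T Q ∧ IsExtension P E (Q⟦(-1 : ℤ)⟧)

variable (t) in
/-- The coaisle of the left tilt: the objects `E` in `D^{≥ 1}` with `H¹(E)` torsion-free,
described as the extensions of an object of `D^{≥ 2}` by an object of `F[-1]`. -/
def tiltCoaisle (F : ObjectProperty D) : ObjectProperty D := fun E =>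
  ∃ Q R, F Q ∧ t.ge 2 R ∧ IsExtension (Q⟦(-1 : ℤ)⟧) E R

instance (T : ObjectProperty D) : (tiltAisle t T).IsClosedUnderIsomorphisms where
  of_iso := by
    rintro X Y e ⟨P, Q, hP, hQ, h⟩
    exact ⟨P, Q, hP, hQ, h.congr (Iso.refl _) e (Iso.refl _)⟩

instance (F : ObjectProperty D) : (tiltCoaisle t F).IsClosedUnderIsomorphisms where
  of_iso := by
    rintro X Y e ⟨P, Q, hP, hQ, h⟩
    exact ⟨P, Q, hP, hQ, h.congr (Iso.refl _) e (Iso.refl _)⟩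

namespace IsHeartTorsionPair

variable {T F : ObjectProperty D} (h : IsHeartTorsionPair t T F)

include h

lemma le_one_of_tiltAisle {X : D} (hX : tiltAisle t T X) : t.le 1 X := by
  obtain ⟨P, Q, hP, hQ, hPQ⟩ := hX
  exact hPQ.le₂ t (t.le_monotone (by lia) _ hP)
    ((le_shift_iff t 0 (-1) 1 (by lia)).2 (h.torsion_le _ hQ).1)

lemma ge_one_of_tiltCoaisle {X : D} (hX : tiltCoaisle t F X) : t.ge 1 X := by
  obtain ⟨P, Q, hP, hQ, hPQ⟩ := hX
  exact hPQ.ge₂ t ((ge_shift_iff t 0 (-1) 1 (by lia)).2 (h.torsionFree_le _ hP).2)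
    (t.ge_antitone (by lia) _ hQ)

lemma tiltAisle_of_le {X : D} (hX : t.le 0 X) : tiltAisle t T X :=
  ⟨X, _, hX, h.torsion_of_isZero (isZero_zero D), IsExtension.of_isZero_right (Iso.refl _)
    ((shiftFunctor D (-1 : ℤ)).map_isZero (isZero_zero D))⟩

lemma tiltCoaisle_of_ge {X : D} (hX : t.ge 2 X) : tiltCoaisle t F X :=
  ⟨_, X, h.torsionFree_of_isZero (isZero_zero D), hX, IsExtension.of_isZero_left
    ((shiftFunctor D (-1 : ℤ)).map_isZero (isZero_zero D)) (Iso.refl _)⟩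

lemma tiltAisle_shift_of_torsion {X : D} (hX : T X) : tiltAisle t T (X⟦(-1 : ℤ)⟧) :=
  ⟨_, X, le_of_isZero t (isZero_zero D) 0, hX, IsExtension.of_isZero_left (isZero_zero D)
    (Iso.refl _)⟩

lemma tiltCoaisle_shift_of_torsionFree {X : D} (hX : F X) : tiltCoaisle t F (X⟦(-1 : ℤ)⟧) :=
  ⟨X, _, hX, ge_of_isZero t (isZero_zero D) 2, IsExtension.of_isZero_right (Iso.refl _)
    (isZero_zero D)⟩

lemma tilt_hom_eq_zero {X Y : D} (f : X ⟶ Y) (hX : tiltAisle t T X) (hY : tiltCoaisle t F Y) :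
    f = 0 := by
  have hY' := h.ge_one_of_tiltCoaisle hY
  obtain ⟨P, Q, hP, hQ, a, b, c, hT⟩ := hX
  obtain ⟨Q', R, hQ', hR, a', b', c', hT'⟩ := hY
  obtain ⟨f', hf'⟩ := Triangle.yoneda_exact₂ _ hT f (HeartTilting.hom_eq_zero t _ hP hY' (by lia))
  obtain ⟨f'', hf''⟩ := Triangle.coyoneda_exact₂ _ hT' f'
    (HeartTilting.hom_eq_zero t _
      ((le_shift_iff t 0 (-1) 1 (by lia)).2 (h.torsion_le _ hQ).1) hR (by lia))
  obtain ⟨r, rfl⟩ := (shiftFunctor D (-1 : ℤ)).map_surjective f''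
  rw [hf', hf'', h.hom_eq_zero r hQ hQ', Functor.map_zero]
  exact (congrArg _ zero_comp).trans comp_zero

lemma exists_tilt_isExtension (X : D) :
    ∃ U V, tiltAisle t T U ∧ tiltCoaisle t F V ∧ IsExtension U X V := by
  obtain ⟨P, Y, hP, hY, h₁⟩ := HeartTilting.exists_isExtension t X (show (0 : ℤ) + 1 = 1 by lia)
  obtain ⟨A, R, hA, hR, h₂⟩ := HeartTilting.exists_isExtension t Y (show (1 : ℤ) + 1 = 2 by lia)
  have hA' : t.ge 1 A := h₂.invRotate.ge₂ t
    (t.ge_antitone (show (1 : ℤ) ≤ 3 by lia) _ ((ge_shift_iff t 2 (-1) 3 (by lia)).2 hR)) hY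
  obtain ⟨B, C, hB, hC, h₃⟩ := h.exists_isExtension (A⟦(1 : ℤ)⟧)
    ⟨(le_shift_iff t 1 1 0 (by lia)).2 hA, (ge_shift_iff t 1 1 0 (by lia)).2 hA'⟩
  have h₃' := (h₃.shift (-1)).congr (Iso.refl _) (shiftShiftNeg A (1 : ℤ)) (Iso.refl _)
  -- regroup `D^{≤ 0} ⋆ (T[-1] ⋆ F[-1]) ⋆ D^{≥ 2}` as `(D^{≤ 0} ⋆ T[-1]) ⋆ (F[-1] ⋆ D^{≥ 2})`
  obtain ⟨V, hV, hV'⟩ := h₃'.assoc_left h₂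
  obtain ⟨U, hU, hU'⟩ := h₁.assoc_right hV
  exact ⟨U, V, ⟨P, B, hP, hB, hU⟩, ⟨C, R, hC, hR, hV'⟩, hU'⟩

end IsHeartTorsionPair

/-- The left tilt of a t-structure with respect to a torsion pair in its heart. -/
def IsHeartTorsionPair.tilt {T F : ObjectProperty D} (h : IsHeartTorsionPair t T F) :
    TStructure D where
  le n X := tiltAisle t T (X⟦n⟧)
  ge n X := tiltCoaisle t F (X⟦n - 1⟧)
  le_isClosedUnderIsomorphisms n :=
    ⟨fun e hX => (tiltAisle t T).prop_of_iso ((shiftFunctor D n).mapIso e) hX⟩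
  ge_isClosedUnderIsomorphisms n :=
    ⟨fun e hX => (tiltCoaisle t F).prop_of_iso ((shiftFunctor D (n - 1)).mapIso e) hX⟩
  le_shift n a n' hn X hX :=
    (tiltAisle t T).prop_of_iso ((shiftFunctorAdd' D a n' n hn).app X) hX
  ge_shift n a n' hn X hX :=
    (tiltCoaisle t F).prop_of_iso ((shiftFunctorAdd' D a (n' - 1) (n - 1) (by lia)).app X) hX
  zero' X Y f hX hY := by
    have hX' := (tiltAisle t T).prop_of_iso ((shiftFunctorZero D ℤ).app X) hX
    have hY' := (tiltCoaisle t F).prop_of_iso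
      ((shiftFunctorZero' D ((1 : ℤ) - 1) (by lia)).app Y) hY
    exact h.tilt_hom_eq_zero f hX' hY'
  le_zero_le X hX := by
    have hX' := (tiltAisle t T).prop_of_iso ((shiftFunctorZero D ℤ).app X) hX
    exact h.tiltAisle_of_le ((le_shift_iff t 1 1 0 (by lia)).2 (h.le_one_of_tiltAisle hX'))
  ge_one_le X hX := by
    have hX' := (tiltCoaisle t F).prop_of_iso
      ((shiftFunctorZero' D ((1 : ℤ) - 1) (by lia)).app X) hX
    exact h.tiltCoaisle_of_ge ((ge_shift_iff t 1 (0 - 1) 2 (by lia)).2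
      (h.ge_one_of_tiltCoaisle hX'))
  exists_triangle_zero_one X := by
    obtain ⟨U, V, hU, hV, f, g, k, hT⟩ := h.exists_tilt_isExtension X
    exact ⟨U, V, (tiltAisle t T).prop_of_iso ((shiftFunctorZero D ℤ).app U).symm hU,
      (tiltCoaisle t F).prop_of_iso ((shiftFunctorZero' D ((1 : ℤ) - 1) (by lia)).app V).symm hV,
      f, g, k, hT⟩

namespace IsHeartTorsionPair

variable {T F : ObjectProperty D} (h : IsHeartTorsionPair t T F)

lemma tilt_le_zero : h.tilt.le 0 = tiltAisle t T := by
  ext X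
  exact (tiltAisle t T).prop_iff_of_iso ((shiftFunctorZero D ℤ).app X)

lemma le_tilt : t.le 0 ≤ h.tilt.le 0 := by
  rw [tilt_le_zero]
  exact fun X hX => h.tiltAisle_of_le hX

lemma tilt_le : h.tilt.le 0 ≤ t.le 1 := by
  rw [tilt_le_zero]
  exact fun X hX => h.le_one_of_tiltAisle hX

/-- The torsion class is recovered from the aisle of the tilt. -/
lemma shift_mem_tilt_iff {X : D} (hX : t.heart X) : h.tilt.le 0 (X⟦(-1 : ℤ)⟧) ↔ T X := by
  rw [tilt_le_zero]
  refine ⟨fun hX' => h.torsion_iff.2 ⟨hX, fun Y f hY => ?_⟩, h.tiltAisle_shift_of_torsion⟩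
  refine (shiftFunctor D (-1 : ℤ)).map_injective ?_
  rw [Functor.map_zero]
  exact h.tilt_hom_eq_zero _ hX' (h.tiltCoaisle_shift_of_torsionFree hY)

/-- The heart of the left tilt in terms of the cohomology objects of the original t-structure. -/
lemma tilt_heart_iff (hb : IsBounded t) {X : D} : h.tilt.heart X ↔
    (∀ i : ℤ, i ≠ 0 → i ≠ 1 → IsZero (cohomology t i X)) ∧
      F (cohomology t 0 X) ∧ T (cohomology t 1 X) := by
  have := h.torsion_iso
  have := h.torsionFree_iso
  constructor
  · rintro ⟨hU, hV⟩
    rw [tilt_le_zero] at hU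
    have hX₁ := h.le_one_of_tiltAisle hU
    have hX₀ : t.ge 0 X :=
      (ge_shift_iff t 0 (0 - 1) 1 (by lia)).1 (h.ge_one_of_tiltCoaisle hV)
    refine ⟨fun i h₀ h₁ => ?_, ?_, ?_⟩
    · obtain hi | hi : i < 0 ∨ 1 < i := by lia
      · exact isZero_cohomology_of_ge t hX₀ hi
      · exact isZero_cohomology_of_le t hX₁ hi
    · obtain ⟨Q, R, hQ, hR, hQR⟩ := hV
      have hQR' := (hQR.shift 1).congr (shiftNegShift Q (1 : ℤ))
        (((shiftFunctorAdd' D (0 - 1 : ℤ) 1 0 (by lia)).app X).symm ≪≫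
          (shiftFunctorZero D ℤ).app X) (Iso.refl _)
      obtain ⟨e⟩ := nonempty_cohomology_iso_left t hQR' 0
        ((ge_shift_iff t 2 1 (0 + 1) (by lia)).2 hR)
      obtain ⟨e'⟩ := nonempty_cohomology_iso_shift t (h.torsionFree_le _ hQ).1
        (h.torsionFree_le _ hQ).2
      exact F.prop_of_iso (e ≪≫ e' ≪≫ (shiftFunctorZero D ℤ).app Q).symm hQ
    · obtain ⟨P, R, hP, hR, hPR⟩ := hU
      obtain ⟨e⟩ := nonempty_cohomology_iso_right t hPR 1 hP
      obtain ⟨e'⟩ := nonempty_cohomology_iso_shift t (i := 1)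
        ((le_shift_iff t 0 (-1) 1 (by lia)).2 (h.torsion_le _ hR).1)
        ((ge_shift_iff t 0 (-1) 1 (by lia)).2 (h.torsion_le _ hR).2)
      exact T.prop_of_iso (e ≪≫ e' ≪≫ shiftNegShift R (1 : ℤ)).symm hR
  · rintro ⟨h₀₁, hF, hT⟩
    have hX₁ : t.le 1 X := le_of_isZero_cohomology t hb 1
      (fun i hi => h₀₁ i (by lia) (by lia))
    have hX₀ : t.ge 0 X := ge_of_isZero_cohomology t hb 0
      (fun i hi => h₀₁ i (by lia) (by lia))
    obtain ⟨P, Q, hP, hQ, hPQ⟩ := HeartTilting.exists_isExtension t X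
      (show (0 : ℤ) + 1 = 1 by lia)
    have hP' : t.ge 0 P := hPQ.invRotate.ge₂ t
      (t.ge_antitone (show (0 : ℤ) ≤ 2 by lia) _ ((ge_shift_iff t 1 (-1) 2 (by lia)).2 hQ)) hX₀
    have hQ' : t.le 1 Q := hPQ.rotate.le₂ t hX₁
      (t.le_monotone (show (-1 : ℤ) ≤ 1 by lia) _ ((le_shift_iff t 0 1 (-1) (by lia)).2 hP))
    obtain ⟨e₀⟩ := nonempty_cohomology_iso_left t hPQ 0 hQ
    obtain ⟨e₀'⟩ := nonempty_cohomology_iso_shift t hP hP'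
    obtain ⟨e₁⟩ := nonempty_cohomology_iso_right t hPQ 1 hP
    obtain ⟨e₁'⟩ := nonempty_cohomology_iso_shift t hQ' hQ
    have hP₀ := F.prop_of_iso (e₀ ≪≫ e₀' ≪≫ (shiftFunctorZero D ℤ).app P) hF
    have hQ₁ := T.prop_of_iso (e₁ ≪≫ e₁') hT
    constructor
    · rw [tilt_le_zero]
      exact ⟨P, _, hP, hQ₁, hPQ.congr (Iso.refl _) (Iso.refl _) (shiftShiftNeg Q (1 : ℤ)).symm⟩
    · exact ⟨P, _, hP₀, (ge_shift_iff t 1 (0 - 1) 2 (by lia)).2 hQ,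
        (hPQ.shift (0 - 1)).congr (eqToIso (by rw [zero_sub])) (Iso.refl _) (Iso.refl _)⟩

lemma tilt_isBounded (hb : IsBounded t) : IsBounded h.tilt := by
  rw [IsBounded, eq_top_iff]
  intro X _
  obtain ⟨a, b, hb, ha⟩ := exists_le_ge t hb X
  refine ⟨⟨a - 1, ⟨?_⟩⟩, ⟨b, ⟨le_le_le_of_le h.le_tilt b _ hb⟩⟩⟩
  exact h.tiltCoaisle_of_ge ((ge_shift_iff t a (a - 1 - 1) 2 (by lia)).2 ha)

end IsHeartTorsionPair

end Tilt

section Intermediate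

variable {D : Type u} [Category.{v} D] [Preadditive D] [HasZeroObject D] [HasShift D ℤ]
  [∀ n : ℤ, (shiftFunctor D n).Additive] [Pretriangulated D] [IsTriangulated D]
  {t t' : TStructure D}

/-! ### Bounded t-structures are determined by their hearts -/

/-- An object of the aisle of a bounded t-structure is an iterated extension of shifts `H⟦k⟧`, with
`k ≥ 0`, of objects of the heart. -/
lemma le_zero_le_of_heart_le (hb : IsBounded t) (h : t.heart ≤ t'.heart) :
    t.le 0 ≤ t'.le 0 := by
  have key : ∀ (k : ℕ) (X : D), t.le 0 X → t.ge (-k + 1) X → t'.le 0 X := by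
    intro k
    induction k with
    | zero =>
      intro X h₁ h₂
      exact le_of_isZero t' (isZero_of_le_of_ge t h₁ h₂ (by simp)) 0
    | succ k ih =>
      intro X h₁ h₂
      obtain ⟨P, Q, hP, hQ, hPQ⟩ := exists_isExtension t X (m := -k) (n := -k + 1) rfl
      have hP' : t.ge (-k) P := hPQ.invRotate.ge₂ t
        (t.ge_antitone (by lia) _ ((ge_shift_iff t (-k + 1) (-1) (-k + 2) (by lia)).2 hQ))
        (t.ge_antitone (by push_cast; lia) _ h₂)
      have hQ' : t.le 0 Q := hPQ.rotate.le₂ t h₁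
        (t.le_monotone (by lia) _ ((le_shift_iff t (-k) 1 (-k - 1) (by lia)).2 hP))
      refine hPQ.le₂ t' ?_ (ih Q hQ' hQ)
      have := h (P⟦(-k : ℤ)⟧) ⟨(le_shift_iff t (-k) (-k) 0 (by lia)).2 hP,
        (ge_shift_iff t (-k) (-k) 0 (by lia)).2 hP'⟩
      exact t'.le_monotone (by lia) _ ((le_shift_iff t' (-k) (-k) 0 (by lia)).1 this.1)
  intro X hX
  obtain ⟨a, _, _, ha⟩ := exists_le_ge t hb X
  exact key (1 - a).toNat X hX (t.ge_antitone (by lia) _ ha)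

lemma tStructure_ext_of_heart (hb : IsBounded t) (hb' : IsBounded t') (h : t.heart = t'.heart) :
    t = t' :=
  tStructure_ext (le_antisymm (le_zero_le_of_heart_le hb h.le) (le_zero_le_of_heart_le hb' h.ge))

lemma isLeftTilt_tilt (hb : IsBounded t) {T F : ObjectProperty (HeartCat t)}
    (h : IsTorsionPair T F) : IsLeftTilt t T F h.ambient.tilt := by
  refine ⟨h, h.ambient.tilt_isBounded hb, ?_⟩
  ext X
  have := h.closedUnderIso_torsion
  have := h.closedUnderIso_torsionFree
  rw [h.ambient.tilt_heart_iff hb, tiltedHeart, map_ι_iff_ambient, map_ι_iff_ambient]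

lemma IsLeftTilt.eq_tilt (hb : IsBounded t) {T F : ObjectProperty (HeartCat t)}
    (h : IsLeftTilt t T F t') : t' = h.1.ambient.tilt :=
  tStructure_ext_of_heart h.2.1 (h.1.ambient.tilt_isBounded hb)
    (h.2.2.trans (isLeftTilt_tilt hb h.1).2.2.symm)

/-! ### Torsion classes and intermediate t-structures -/

/-- The torsion pair induced by an intermediate t-structure `t'`: the decomposition of `E` is the
`t'`-truncation triangle of `E[-1]`, shifted back. -/
lemma isHeartTorsionPair_of_intermediate (h₁ : t.le 0 ≤ t'.le 0) (h₂ : t'.le 0 ≤ t.le 1) :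
    IsHeartTorsionPair t (fun X => t.heart X ∧ t'.le 0 (X⟦(-1 : ℤ)⟧))
      (fun X => t.heart X ∧ t'.ge 1 (X⟦(-1 : ℤ)⟧)) where
  torsion_le _ h := h.1
  torsionFree_le _ h := h.1
  torsion_iso := ⟨fun e hX => ⟨t.heart.prop_of_iso e hX.1,
    (t'.le 0).prop_of_iso ((shiftFunctor D (-1 : ℤ)).mapIso e) hX.2⟩⟩
  torsionFree_iso := ⟨fun e hX => ⟨t.heart.prop_of_iso e hX.1,
    (t'.ge 1).prop_of_iso ((shiftFunctor D (-1 : ℤ)).mapIso e) hX.2⟩⟩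
  hom_eq_zero X Y f hX hY := by
    refine (shiftFunctor D (-1 : ℤ)).map_injective ?_
    rw [Functor.map_zero]
    exact hom_eq_zero t' _ hX.2 hY.2 (by lia)
  exists_isExtension E hE := by
    obtain ⟨P, Q, hP, hQ, h⟩ := exists_isExtension t' (E⟦(-1 : ℤ)⟧) (show (0 : ℤ) + 1 = 1 by lia)
    have hP₁ := h₂ _ hP
    have hQ₁ := ge_le_ge_of_le h₁ 1 _ hQ
    have hQ₂ : t.le 1 Q := h.rotate.le₂ t ((le_shift_iff t 0 (-1) 1 (by lia)).2 hE.1)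
      (t.le_monotone (show (0 : ℤ) ≤ 1 by lia) _ ((le_shift_iff t 1 1 0 (by lia)).2 hP₁))
    have hP₂ : t.ge 1 P := h.invRotate.ge₂ t
      (t.ge_antitone (show (1 : ℤ) ≤ 2 by lia) _ ((ge_shift_iff t 1 (-1) 2 (by lia)).2 hQ₁))
      ((ge_shift_iff t 0 (-1) 1 (by lia)).2 hE.2)
    refine ⟨P⟦(1 : ℤ)⟧, Q⟦(1 : ℤ)⟧, ⟨⟨(le_shift_iff t 1 1 0 (by lia)).2 hP₁,
      (ge_shift_iff t 1 1 0 (by lia)).2 hP₂⟩, ?_⟩, ⟨⟨(le_shift_iff t 1 1 0 (by lia)).2 hQ₂,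
      (ge_shift_iff t 1 1 0 (by lia)).2 hQ₁⟩, ?_⟩,
      (h.shift 1).congr (Iso.refl _) (shiftNegShift E (1 : ℤ)) (Iso.refl _)⟩
    · exact (t'.le 0).prop_of_iso (shiftShiftNeg P (1 : ℤ)).symm hP
    · exact (t'.ge 1).prop_of_iso (shiftShiftNeg Q (1 : ℤ)).symm hQ

/-- An intermediate t-structure is the tilt with respect to the torsion pair it induces. -/
lemma tilt_of_intermediate (h₁ : t.le 0 ≤ t'.le 0) (h₂ : t'.le 0 ≤ t.le 1) :
    (isHeartTorsionPair_of_intermediate h₁ h₂).tilt = t' := by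
  refine tStructure_ext ?_
  rw [IsHeartTorsionPair.tilt_le_zero]
  ext X
  constructor
  · rintro ⟨P, Q, hP, hQ, h⟩
    exact h.le₂ t' (h₁ _ hP) hQ.2
  · intro hX
    obtain ⟨P, Q, hP, hQ, h⟩ := exists_isExtension t X (show (0 : ℤ) + 1 = 1 by lia)
    have hQ₁ : t.le 1 Q := h.rotate.le₂ t (h₂ _ hX)
      (t.le_monotone (show (-1 : ℤ) ≤ 1 by lia) _ ((le_shift_iff t 0 1 (-1) (by lia)).2 hP))
    have hQ' : t'.le 0 Q := h.rotate.le₂ t' hX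
      (t'.le_monotone (show (-1 : ℤ) ≤ 0 by lia) _
        ((le_shift_iff t' 0 1 (-1) (by lia)).2 (h₁ _ hP)))
    refine ⟨P, Q⟦(1 : ℤ)⟧, hP, ⟨⟨(le_shift_iff t 1 1 0 (by lia)).2 hQ₁,
      (ge_shift_iff t 1 1 0 (by lia)).2 hQ⟩, ?_⟩,
      h.congr (Iso.refl _) (Iso.refl _) (shiftShiftNeg Q (1 : ℤ)).symm⟩
    exact (t'.le 0).prop_of_iso (shiftShiftNeg Q (1 : ℤ)).symm hQ'

/-- The torsion class in the heart of `t` attached to an intermediate t-structure `t'`. -/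
def torsionOf (t t' : TStructure D) : ObjectProperty (HeartCat t) :=
  fun X => t'.le 0 (X.obj⟦(-1 : ℤ)⟧)

lemma isTorsionClass_torsionOf (h₁ : t.le 0 ≤ t'.le 0) (h₂ : t'.le 0 ≤ t.le 1) :
    IsTorsionClass (torsionOf t t') := by
  refine ⟨_, (congrArg (fun P => IsTorsionPair P _) ?_).mp
    (isHeartTorsionPair_of_intermediate h₁ h₂).isTorsionPair⟩
  ext X
  exact ⟨fun h => h.2, fun h => ⟨X.2, h⟩⟩

/-- The left tilt with respect to a torsion class. -/
def tiltOf (T : TorsionClass t) : TStructure D := T.2.choose_spec.ambient.tilt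

lemma torsionOf_tiltOf (T : TorsionClass t) : torsionOf t (tiltOf T) = T.1 := by
  ext X
  exact (IsHeartTorsionPair.shift_mem_tilt_iff _ X.2).trans (ambient_obj t)

lemma tiltOf_le_tiltOf {T T' : TorsionClass t} (h : T ≤ T') :
    (tiltOf T).le 0 ≤ (tiltOf T').le 0 := by
  rw [tiltOf, tiltOf, IsHeartTorsionPair.tilt_le_zero, IsHeartTorsionPair.tilt_le_zero]
  rintro X ⟨P, Q, hP, hQ, hPQ⟩
  exact ⟨P, Q, hP, ambient_le t h _ hQ, hPQ⟩

lemma tiltOf_torsionOf (h₁ : t.le 0 ≤ t'.le 0) (h₂ : t'.le 0 ≤ t.le 1) :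
    tiltOf ⟨torsionOf t t', isTorsionClass_torsionOf h₁ h₂⟩ = t' := by
  refine Eq.trans (tStructure_ext ?_) (tilt_of_intermediate h₁ h₂)
  rw [tiltOf, IsHeartTorsionPair.tilt_le_zero, IsHeartTorsionPair.tilt_le_zero]
  congr 1
  ext X
  exact ⟨fun ⟨h, h'⟩ => ⟨h, h'⟩, fun ⟨h, h'⟩ => ⟨h, h'⟩⟩

/-- Torsion classes in the heart of a bounded t-structure correspond to the intermediate
t-structures, compatibly with inclusion. -/
def torsionClassOrderIso (hb : IsBounded t) : TorsionClass t ≃o IntermediateTStructure t where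
  toFun T := ⟨tiltOf T, IsHeartTorsionPair.tilt_isBounded _ hb, IsHeartTorsionPair.le_tilt _,
    IsHeartTorsionPair.tilt_le _⟩
  invFun C := ⟨torsionOf t C.str, isTorsionClass_torsionOf C.le_str C.str_le⟩
  left_inv T := Subtype.ext (torsionOf_tiltOf T)
  right_inv C := by
    obtain ⟨s, hs, h₁, h₂⟩ := C
    have : tiltOf ⟨torsionOf t s, isTorsionClass_torsionOf h₁ h₂⟩ = s := tiltOf_torsionOf h₁ h₂
    simp only [this]
  map_rel_iff' := by
    intro T T'
    refine ⟨fun h => ?_, tiltOf_le_tiltOf⟩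
    change T.1 ≤ T'.1
    rw [← torsionOf_tiltOf T, ← torsionOf_tiltOf T']
    exact fun X hX => h _ hX

lemma isLeftTilt_torsionClassOrderIso (hb : IsBounded t) (T : TorsionClass t) :
    ∃ F, IsLeftTilt t T.1 F (torsionClassOrderIso hb T).str :=
  ⟨_, isLeftTilt_tilt hb T.2.choose_spec⟩

end Intermediate

section Noetherian

variable {A : Type u} [Category.{v} A] [Abelian A]

/-! ### Finite length and simple torsion pairs -/

/-- If `E` is noetherian and `P` is stable under extensions by objects of a class `C` of nonzero
objects, then a maximal subobject of `E` in `P` has a quotient without subobjects in `C`. -/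
lemma exists_shortExact_of_isNoetherianObject {E : A} (hE : isNoetherianObject E)
    (P C : ObjectProperty A) [P.IsClosedUnderIsomorphisms] (hP : ∀ X, IsZero X → P X) (hC : ∀ X, C X → ¬ IsZero X)
    (hext : ∀ K : ShortComplex A, K.ShortExact → P K.X₁ → C K.X₃ → P K.X₂) :
    ∃ (X Y : A) (f : X ⟶ E) (g : E ⟶ Y) (w : f ≫ g = 0), (ShortComplex.mk f g w).ShortExact ∧
      P X ∧ ∀ (S : A) (i : S ⟶ Y), C S → ¬ Mono i := by
  have : WellFoundedGT (Subobject E) := hE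
  obtain ⟨N, hN, hmax⟩ := wellFounded_gt.has_min {N : Subobject E | P (N : A)}
    ⟨⊥, hP _ ((isZero_zero A).of_iso Subobject.botCoeIsoZero)⟩
  have hk : IsLimit (KernelFork.ofι N.arrow (cokernel.condition N.arrow)) :=
    Abelian.monoIsKernelOfCokernel _ (colimit.isColimit _)
  refine ⟨N, cokernel N.arrow, N.arrow, cokernel.π N.arrow, cokernel.condition _,
    { exact := ShortComplex.exact_of_f_is_kernel _ hk }, hN, fun S i hS hi => ?_⟩
  let M := pullback i (cokernel.π N.arrow)
  let j : (N : A) ⟶ M := pullback.lift 0 N.arrow (by rw [zero_comp, cokernel.condition])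
  have hj₁ : j ≫ pullback.fst _ _ = 0 := pullback.lift_fst _ _ _
  have hj₂ : j ≫ pullback.snd _ _ = N.arrow := pullback.lift_snd _ _ _
  have hjm : Mono j := by
    have : Mono (j ≫ pullback.snd i (cokernel.π N.arrow)) := by rw [hj₂]; infer_instance
    exact mono_of_mono j (pullback.snd i (cokernel.π N.arrow))
  have hj : IsLimit (KernelFork.ofι j hj₁) := by
    refine KernelFork.IsLimit.ofι' j hj₁ (fun {W} k hk' => ?_)
    have hw : (k ≫ pullback.snd i (cokernel.π N.arrow)) ≫ cokernel.π N.arrow = 0 := by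
      rw [Category.assoc, ← pullback.condition, reassoc_of% hk', zero_comp]
    refine ⟨hk.lift (KernelFork.ofι _ hw), ?_⟩
    have hl : hk.lift (KernelFork.ofι _ hw) ≫ N.arrow = _ :=
      hk.fac (KernelFork.ofι _ hw) WalkingParallelPair.zero
    refine pullback.hom_ext ?_ ?_
    · rw [Category.assoc, hj₁, hk', comp_zero]
    · rw [Category.assoc, hj₂, hl]
      rfl
  have hse : (ShortComplex.mk j (pullback.fst _ _) hj₁).ShortExact :=
    { exact := ShortComplex.exact_of_f_is_kernel _ hj }
  have hM : P M := hext _ hse hN hS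
  refine hmax (Subobject.mk (pullback.snd i (cokernel.π N.arrow))) ?_ ?_
  · exact P.prop_of_iso (Subobject.underlyingIso (pullback.snd i (cokernel.π N.arrow))).symm hM
  · have hlt : Subobject.mk N.arrow < Subobject.mk (pullback.snd i (cokernel.π N.arrow)) := by
      refine Subobject.mk_lt_mk_of_comm j hj₂ fun hiso => hC S hS ?_
      have : pullback.fst i (cokernel.π N.arrow) = 0 := by
        rw [← cancel_epi j, hj₁, comp_zero]
      rw [IsZero.iff_id_eq_zero, ← cancel_epi (pullback.fst i (cokernel.π N.arrow)), this,
        zero_comp, zero_comp]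
    rwa [Subobject.mk_arrow] at hlt

instance (S : A) : (extClosure S).IsClosedUnderIsomorphisms := ⟨fun e h => .iso _ _ e h⟩

lemma extClosure_hom_eq_zero {S X Y : A} (f : X ⟶ Y) (hX : extClosure S X)
    (hY : homOrthogonal S Y) : f = 0 := by
  induction hX with
  | zero X hX => exact hX.eq_of_src _ _
  | self => exact hY f
  | iso X X' e _ ih => rw [← cancel_epi e.hom, ih (e.hom ≫ f), comp_zero]
  | ext K hK _ _ ih₁ ih₃ =>
    have := hK.epi_g
    obtain ⟨r, hr⟩ : ∃ r, K.g ≫ r = f :=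
      ⟨_, hK.gIsCokernel.fac (CokernelCofork.ofπ f (ih₁ (K.f ≫ f))) WalkingParallelPair.one⟩
    rw [← hr, ih₃ r, comp_zero]

/-- The simple torsion pair attached to a simple object of a noetherian abelian category. -/
lemma isTorsionPair_extClosure (hA : ∀ E : A, isNoetherianObject E) (S : A) [Simple S] :
    IsTorsionPair (extClosure S) (homOrthogonal S) where
  closedUnderIso_torsion := inferInstance
  closedUnderIso_torsionFree := ⟨fun e h f => by
    rw [← cancel_mono e.inv, h (f ≫ e.inv), zero_comp]⟩
  hom_eq_zero _ _ f hX hY := extClosure_hom_eq_zero f hX hY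
  exists_shortExact E := by
    obtain ⟨X, Y, f, g, w, h, hX, hY⟩ := exists_shortExact_of_isNoetherianObject (hA E)
      (extClosure S) (fun S' => S' = S) .zero (fun X hX => by rw [hX]; exact Simple.not_isZero S)
      (fun K hK h₁ h₃ => .ext K hK h₁ (by rw [h₃]; exact .self))
    refine ⟨X, Y, f, g, w, hX, fun i => ?_, h⟩
    by_contra hi
    exact hY S i rfl (mono_of_nonzero_from_simple hi)

end Noetherian

section Length

variable {D : Type u} [Category.{v} D] [Preadditive D] [HasZeroObject D] [HasShift D ℤ]
  [∀ n : ℤ, (shiftFunctor D n).Additive] [Pretriangulated D] [IsTriangulated D]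
  {t : TStructure D}

variable (t) in
/-- `HasLength t E n`: the object `E` of the heart has a filtration with `n` simple
subquotients. -/
inductive HasLength : HeartCat t → ℕ → Prop
  | zero (X : HeartCat t) (hX : IsZero X) : HasLength X 0
  | ext (X E S : HeartCat t) (n : ℕ) (hX : HasLength X n) (hS : Simple S)
      (h : IsExtension X.obj E.obj S.obj) : HasLength E (n + 1)

lemma HasLength.of_iso {X Y : HeartCat t} {n : ℕ} (h : HasLength t X n) (e : X.obj ≅ Y.obj) :
    HasLength t Y n := by
  cases h with
  | zero _ hX => exact .zero _ (hX.of_iso (heartIso t e).symm)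
  | ext X' _ S n hX hS h => exact .ext X' _ S n hX hS (h.congr (Iso.refl _) e (Iso.refl _))

lemma HasLength.extension {X E Y : HeartCat t} {a b : ℕ} (hX : HasLength t X a)
    (hY : HasLength t Y b) (h : IsExtension X.obj E.obj Y.obj) : HasLength t E (a + b) := by
  induction hY generalizing E with
  | zero Y hY =>
    obtain ⟨e⟩ := h.nonempty_iso_of_isZero_right ((isZero_iff_isZero_obj t).1 hY)
    exact hX.of_iso e
  | ext Y' Y S n _ hS hY' ih =>
    obtain ⟨W, hW, hW'⟩ := h.assoc_right hY'
    exact .ext ⟨W, hW.heart₂ t X.2 Y'.2⟩ _ S _ (ih hW) hS hW'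

lemma isZero_of_isExtension {X E Y : D} (hX : t.heart X) (hY : t.heart Y)
    (h : IsExtension X E Y) (hE : IsZero E) : IsZero X ∧ IsZero Y := by
  have hY' : IsZero Y := by
    obtain ⟨e⟩ := h.rotate.nonempty_iso_of_isZero_left hE
    refine isZero_of_le_of_ge t (m := -1) ((t.le (-1)).prop_of_iso e.symm ?_) hY.2 (by lia)
    exact (le_shift_iff t 0 1 (-1) (by lia)).2 hX.1
  obtain ⟨e⟩ := h.nonempty_iso_of_isZero_right hY'
  exact ⟨hE.of_iso e, hY'⟩

/-- The numbers of simple subquotients in a filtration of an extension split up. The proof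
intersects the filtration of `E` with the subobject `X`. -/
lemma HasLength.exists_of_extension {X E Y : HeartCat t} {n : ℕ} (hE : HasLength t E n)
    (h : IsExtension X.obj E.obj Y.obj) :
    ∃ a b, a + b = n ∧ HasLength t X a ∧ HasLength t Y b := by
  induction hE generalizing X Y with
  | zero E hE =>
    obtain ⟨hX, hY⟩ := isZero_of_isExtension X.2 Y.2 h ((isZero_iff_isZero_obj t).1 hE)
    exact ⟨0, 0, rfl, .zero _ ((isZero_iff_isZero_obj t).2 hX),
      .zero _ ((isZero_iff_isZero_obj t).2 hY)⟩
  | ext E' E S n _ hS hE' ih =>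
    -- the composite `X ⟶ E ⟶ S` is zero or an epimorphism
    obtain ⟨i, p, r, hT⟩ := h
    obtain ⟨f, g, k, hT'⟩ := hE'
    by_cases hig : i ≫ g = 0
    · obtain ⟨j, hj⟩ := Triangle.coyoneda_exact₂ _ hT' i hig
      obtain ⟨W, j', j'', hT''⟩ := distinguished_cocone_triangle j
      have hW : IsExtension W Y.obj S.obj :=
        IsExtension.of_triangle _ (someOctahedron hj.symm hT'' hT' hT).mem
      have hW' : IsExtension X.obj E'.obj W := ⟨_, _, _, hT''⟩
      have hWh : t.heart W :=
        ⟨hW'.rotate.le₂ t E'.2.1 (t.le_monotone (show (-1 : ℤ) ≤ 0 by lia) _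
          ((le_shift_iff t 0 1 (-1) (by lia)).2 X.2.1)),
        hW.invRotate.ge₂ t (t.ge_antitone (show (0 : ℤ) ≤ 1 by lia) _
          ((ge_shift_iff t 0 (-1) 1 (by lia)).2 S.2.2)) Y.2.2⟩
      obtain ⟨a, b, hab, ha, hb⟩ := ih (Y := ⟨W, hWh⟩) hW'
      exact ⟨a, b + 1, by lia, ha, .ext _ _ S _ hb hS hW⟩
    · let φ : X ⟶ S := ObjectProperty.homMk (i ≫ g)
      have hφ : φ ≠ 0 := fun h0 => hig (congrArg (fun f => f.hom) h0)
      have : Epi φ := epi_of_nonzero_to_simple hφ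
      obtain ⟨K, q, δ, hK⟩ := AbelianSubcategory.exists_distinguished_triangle_of_epi
        (heart_hom_shift_eq_zero t) (admissibleMorphism_heart t) φ
      have hK' : IsExtension K.obj X.obj S.obj := ⟨_, _, _, hK⟩
      have ho := (IsExtension.of_triangle _ (someOctahedron (show i ≫ g = t.heart.ι.map φ from rfl)
        hT (rot_of_distTriang _ hT') (rot_of_distTriang _ hK)).mem).invRotate.invRotate
      have hKE : IsExtension K.obj E'.obj Y.obj :=
        ho.congr (shiftShiftNeg K.obj (1 : ℤ)) (shiftShiftNeg E'.obj (1 : ℤ)) (Iso.refl _)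
      obtain ⟨a, b, hab, ha, hb⟩ := ih hKE
      exact ⟨a + 1, b, by lia, .ext _ _ S _ ha hS hK', hb⟩

lemma IsAlgebraicHeart.exists_hasLength (ht : IsAlgebraicHeart t) (E : HeartCat t) :
    ∃ n, HasLength t E n := by
  have : ObjectProperty.IsClosedUnderIsomorphisms fun X => ∃ n, HasLength t X n :=
    ⟨fun e ⟨n, hn⟩ => ⟨n, hn.of_iso (t.heart.ι.mapIso e)⟩⟩
  obtain ⟨X, Y, f, g, w, h, ⟨n, hn⟩, hY⟩ := exists_shortExact_of_isNoetherianObject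
    (ht.1 E).2 (fun X => ∃ n, HasLength t X n) (fun S => Simple S) (fun X hX => ⟨0, .zero X hX⟩)
    (fun X hX => Simple.not_isZero X)
    (fun K hK ⟨n, hn⟩ h₃ => ⟨n + 1, .ext _ _ _ _ hn h₃ (isExtension_of_shortExact t hK)⟩)
  have hY0 : IsZero Y := by
    by_contra hY0
    have : IsArtinianObject Y := ⟨(ht.1 Y).1⟩
    obtain ⟨S, hS⟩ := exists_simple_subobject hY0
    exact hY _ S.arrow hS inferInstance
  obtain ⟨e⟩ := (isExtension_of_shortExact t h).nonempty_iso_of_isZero_right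
    ((isZero_iff_isZero_obj t).1 hY0)
  exact ⟨n, hn.of_iso e⟩

lemma IsHeartTorsionPair.torsion_of_quotient {T F : ObjectProperty D}
    (h : IsHeartTorsionPair t T F) {K X Q : D} (hX : T X) (hK : t.heart K) (hQ : t.heart Q)
    (hKQ : IsExtension K X Q) : T Q := by
  obtain ⟨f, g, k, hT⟩ := hKQ
  refine h.torsion_iff.2 ⟨hQ, fun Y r hY => ?_⟩
  obtain ⟨s, hs⟩ := Triangle.yoneda_exact₃ _ hT r (h.hom_eq_zero _ hX hY)
  have hs0 : s = 0 := HeartTilting.hom_eq_zero t s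
    ((le_shift_iff t 0 1 (-1) (by lia)).2 hK.1) (h.torsionFree_le _ hY).2 (by lia)
  rw [hs, hs0]
  exact comp_zero

/-- A nonzero torsion class in a heart of finite length contains a simple object. -/
lemma exists_simple_of_torsion (ht : IsAlgebraicHeart t) {T F : ObjectProperty (HeartCat t)}
    (h : IsTorsionPair T F) {X : HeartCat t} (hX : T X) (hX0 : ¬ IsZero X) :
    ∃ S : HeartCat t, Simple S ∧ T S := by
  obtain ⟨n, hn⟩ := ht.exists_hasLength X
  cases hn with
  | zero _ h0 => exact absurd h0 hX0
  | ext K _ S n _ hS hK =>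
    exact ⟨S, hS, (ambient_obj t).1
      (h.ambient.torsion_of_quotient ((ambient_obj t).2 hX) K.2 S.2 hK)⟩

end Length

section Euler

variable {D : Type u} [Category.{v} D] [Preadditive D] [HasZeroObject D] [HasShift D ℤ]
  [∀ n : ℤ, (shiftFunctor D n).Additive] [Pretriangulated D] [IsTriangulated D]
  {t : TStructure D}

/-! ### Length and Euler characteristic -/

variable (t) in
/-- The length of an object of the heart: the smallest number of simple subquotients in a
filtration. The value is `0` outside the heart and for objects of infinite length. -/
def heartLength (X : D) : ℕ := sInf {n | ∃ h : t.heart X, HasLength t ⟨X, h⟩ n}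

lemma heartLength_le {X : D} (hX : t.heart X) {n : ℕ} (h : HasLength t ⟨X, hX⟩ n) :
    heartLength t X ≤ n := Nat.sInf_le ⟨hX, h⟩

lemma hasLength_heartLength (ht : IsAlgebraicHeart t) {X : D} (hX : t.heart X) :
    HasLength t ⟨X, hX⟩ (heartLength t X) := by
  obtain ⟨n, hn⟩ := ht.exists_hasLength ⟨X, hX⟩
  obtain ⟨_, h⟩ := Nat.sInf_mem (s := {n | ∃ h : t.heart X, HasLength t ⟨X, h⟩ n}) ⟨n, hX, hn⟩
  exact h

lemma heartLength_congr {X Y : D} (e : X ≅ Y) : heartLength t X = heartLength t Y := by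
  have key : ∀ {X Y : D} (e : X ≅ Y) (n : ℕ), (∃ h : t.heart X, HasLength t ⟨X, h⟩ n) →
      ∃ h : t.heart Y, HasLength t ⟨Y, h⟩ n :=
    fun e n ⟨h, hn⟩ => ⟨t.heart.prop_of_iso e h, hn.of_iso e⟩
  unfold heartLength
  congr 1
  ext n
  exact ⟨key e n, key e.symm n⟩

lemma heartLength_of_isZero {X : D} (hX : IsZero X) : heartLength t X = 0 :=
  Nat.le_zero.1 (heartLength_le ⟨le_of_isZero t hX 0, ge_of_isZero t hX 0⟩
    (.zero _ ((isZero_iff_isZero_obj t).2 hX)))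

lemma heartLength_pos (ht : IsAlgebraicHeart t) {X : D} (hX : t.heart X) (h : ¬ IsZero X) :
    0 < heartLength t X := by
  have hl := hasLength_heartLength ht hX
  rw [Nat.pos_iff_ne_zero]
  intro h0
  rw [h0] at hl
  cases hl with
  | zero _ hX0 => exact h ((isZero_iff_isZero_obj t).1 hX0)

/-- Taking the minimum over all filtrations makes the length additive without appealing to the
Jordan–Hölder theorem. -/
lemma heartLength_extension (ht : IsAlgebraicHeart t) {X E Y : D} (hX : t.heart X)
    (hY : t.heart Y) (h : IsExtension X E Y) :
    heartLength t E = heartLength t X + heartLength t Y := by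
  have hE := h.heart₂ t hX hY
  refine le_antisymm (heartLength_le hE
    ((hasLength_heartLength ht hX).extension (hasLength_heartLength ht hY) h)) ?_
  obtain ⟨a, b, hab, ha, hb⟩ := (hasLength_heartLength ht hE).exists_of_extension
    (X := ⟨X, hX⟩) (Y := ⟨Y, hY⟩) h
  have := heartLength_le hX ha
  have := heartLength_le hY hb
  lia

variable (t) in
/-- The Euler characteristic: the alternating sum of the lengths of the cohomology objects. -/
def eulerChar (X : D) : ℤ := ∑ᶠ i : ℤ, (i.negOnePow : ℤ) * heartLength t (cohomology t i X)

lemma finite_support_eulerChar (hb : IsBounded t) (X : D) :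
    (Function.support fun i : ℤ =>
      (i.negOnePow : ℤ) * heartLength t (cohomology t i X)).Finite := by
  obtain ⟨a, b, hX, hX'⟩ := exists_le_ge t hb X
  refine (Set.finite_Icc a b).subset fun i hi => ?_
  by_contra hi'
  apply hi
  have h0 : IsZero (cohomology t i X) := by
    obtain h | h : i < a ∨ b < i := by
      rw [Set.mem_Icc] at hi'
      lia
    · exact isZero_cohomology_of_ge t hX' h
    · exact isZero_cohomology_of_le t hX h
  simp [heartLength_of_isZero h0]

lemma eulerChar_congr {X Y : D} (e : X ≅ Y) : eulerChar t X = eulerChar t Y := by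
  unfold eulerChar
  exact finsum_congr fun i => by rw [heartLength_congr (cohomologyIso t i e)]

lemma eulerChar_of_isZero {X : D} (hX : IsZero X) : eulerChar t X = 0 := by
  unfold eulerChar
  rw [← finsum_zero (α := ℤ)]
  refine finsum_congr fun i => ?_
  rw [heartLength_of_isZero (isZero_cohomology_of_ge t (ge_of_isZero t hX (i + 1)) (by lia))]
  simp

lemma eulerChar_of_le_of_ge {X : D} {n : ℤ} (h₁ : t.le n X) (h₂ : t.ge n X) :
    eulerChar t X = n.negOnePow * heartLength t (X⟦n⟧) := by
  obtain ⟨e⟩ := nonempty_cohomology_iso_shift t h₁ h₂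
  rw [eulerChar, finsum_eq_single _ n, heartLength_congr e]
  intro i hi
  have h0 : IsZero (cohomology t i X) := by
    obtain h | h : i < n ∨ n < i := by lia
    · exact isZero_cohomology_of_ge t h₂ h
    · exact isZero_cohomology_of_le t h₁ h
  simp [heartLength_of_isZero h0]

lemma eulerChar_truncation (hb : IsBounded t) {P X Q : D} (h : IsExtension P X Q) {n : ℤ}
    (hP : t.le (n - 1) P) (hQ : t.ge n Q) : eulerChar t X = eulerChar t P + eulerChar t Q := by
  unfold eulerChar
  rw [← finsum_add_distrib (finite_support_eulerChar hb P) (finite_support_eulerChar hb Q)]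
  refine finsum_congr fun i => ?_
  obtain hi | hi : i < n ∨ n ≤ i := by lia
  · obtain ⟨e⟩ := nonempty_cohomology_iso_left t h i (t.ge_antitone (by lia) _ hQ)
    rw [heartLength_congr e, heartLength_of_isZero (isZero_cohomology_of_ge t hQ hi)]
    simp
  · obtain ⟨e⟩ := nonempty_cohomology_iso_right t h i (t.le_monotone (by lia) _ hP)
    rw [heartLength_congr e, heartLength_of_isZero (isZero_cohomology_of_le t hP (i := i) (by lia))]
    simp

/-- Additivity of the Euler characteristic on triangles whose third term is concentrated in
the top degree. -/
lemma eulerChar_top (hb : IsBounded t) (ht : IsAlgebraicHeart t) {Y Z B : D}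
    (h : IsExtension Y Z B) {n : ℤ} (hY : t.le n Y) (hB : t.le n B) (hB' : t.ge n B) :
    eulerChar t Z = eulerChar t Y + eulerChar t B := by
  obtain ⟨P, Q, hP, hQ, hPQ⟩ := exists_isExtension t Y (sub_add_cancel n 1)
  have hQ' : t.le n Q := hPQ.rotate.le₂ t hY
    (t.le_monotone (show n - 2 ≤ n by lia) _ ((le_shift_iff t (n - 1) 1 (n - 2) (by lia)).2 hP))
  obtain ⟨W, hW, hW'⟩ := hPQ.assoc_left h
  have hlen := heartLength_extension ht
    ⟨(le_shift_iff t n n 0 (by lia)).2 hQ', (ge_shift_iff t n n 0 (by lia)).2 hQ⟩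
    ⟨(le_shift_iff t n n 0 (by lia)).2 hB, (ge_shift_iff t n n 0 (by lia)).2 hB'⟩ (hW'.shift n)
  rw [eulerChar_truncation hb hW hP (hW'.ge₂ t hQ hB'), eulerChar_truncation hb hPQ hP hQ,
    eulerChar_of_le_of_ge (hW'.le₂ t hQ' hB) (hW'.ge₂ t hQ hB'), eulerChar_of_le_of_ge hQ' hQ,
    eulerChar_of_le_of_ge hB hB', hlen]
  push_cast
  ring

lemma nonempty_cohomology_shift_iso (X : D) (i : ℤ) :
    Nonempty (cohomology t i (X⟦(1 : ℤ)⟧) ≅ cohomology t (i + 1) X) := by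
  obtain ⟨P, Q, hP, hQ, h⟩ := exists_isExtension t X (m := i + 1) (n := i + 2) (by lia)
  obtain ⟨R, B, hR, hB, h'⟩ := exists_isExtension t P (m := i) (n := i + 1) rfl
  have hB' : t.le (i + 1) B := h'.rotate.le₂ t hP
    (t.le_monotone (show i - 1 ≤ i + 1 by lia) _ ((le_shift_iff t i 1 (i - 1) (by lia)).2 hR))
  obtain ⟨e₁⟩ := nonempty_cohomology_iso_left t (h.shift 1) i
    ((ge_shift_iff t (i + 2) 1 (i + 1) (by lia)).2 hQ)
  obtain ⟨e₂⟩ := nonempty_cohomology_iso_right t (h'.shift 1) i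
    ((le_shift_iff t i 1 (i - 1) (by lia)).2 hR)
  obtain ⟨e₃⟩ := nonempty_cohomology_iso_shift t
    ((le_shift_iff t (i + 1) 1 i (by lia)).2 hB') ((ge_shift_iff t (i + 1) 1 i (by lia)).2 hB)
  obtain ⟨e₄⟩ := nonempty_cohomology_iso_left t h (i + 1)
    (t.ge_antitone (by lia) _ hQ)
  obtain ⟨e₅⟩ := nonempty_cohomology_iso_right t h' (i + 1) (t.le_monotone (by lia) _ hR)
  obtain ⟨e₆⟩ := nonempty_cohomology_iso_shift t hB' hB
  exact ⟨e₁ ≪≫ e₂ ≪≫ e₃ ≪≫ ((shiftFunctorAdd' D 1 i (i + 1) (by lia)).app B).symm ≪≫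
    (e₄ ≪≫ e₅ ≪≫ e₆).symm⟩

lemma eulerChar_shift_one (X : D) : eulerChar t (X⟦(1 : ℤ)⟧) = - eulerChar t X := by
  unfold eulerChar
  rw [← finsum_comp_equiv (Equiv.addRight (1 : ℤ)) (f := fun i : ℤ =>
    (i.negOnePow : ℤ) * heartLength t (cohomology t i X)), ← finsum_neg_distrib]
  refine finsum_congr fun i => ?_
  obtain ⟨e⟩ := nonempty_cohomology_shift_iso (t := t) X i
  rw [heartLength_congr e, Equiv.coe_addRight, Int.negOnePow_succ]
  simp

lemma eulerChar_shift_neg_one (X : D) : eulerChar t (X⟦(-1 : ℤ)⟧) = - eulerChar t X := by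
  rw [← eulerChar_congr (shiftNegShift X (1 : ℤ)), eulerChar_shift_one, neg_neg]

/-- Removing the top cohomology of the third term of a triangle, which changes the second term
by the same amount. -/
lemma exists_peel (hb : IsBounded t) (ht : IsAlgebraicHeart t) {X Y Z : D}
    (h : IsExtension X Y Z) {n : ℤ} (hX : t.le n X) (hZ : t.le n Z) :
    ∃ Y' Z', IsExtension X Y' Z' ∧ t.le n Y' ∧ t.le (n - 1) Z' ∧
      (∀ m ≤ n, t.ge m Y → t.ge m Y') ∧ (∀ m ≤ n, t.ge m Z → t.ge m Z') ∧
      eulerChar t Y - eulerChar t Z = eulerChar t Y' - eulerChar t Z' := by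
  obtain ⟨Z', B, hZ', hB, hZB⟩ := exists_isExtension t Z (sub_add_cancel n 1)
  have hB' : t.le n B := hZB.rotate.le₂ t hZ
    (t.le_monotone (show n - 2 ≤ n by lia) _ ((le_shift_iff t (n - 1) 1 (n - 2) (by lia)).2 hZ'))
  obtain ⟨Y', hY', hYB⟩ := h.assoc_right hZB
  have hY'' : t.le n Y' := hY'.le₂ t hX (t.le_monotone (by lia) _ hZ')
  have hB'' : t.ge (n + 1) (B⟦(-1 : ℤ)⟧) := (ge_shift_iff t n (-1) (n + 1) (by lia)).2 hB
  refine ⟨Y', Z', hY', hY'', hZ', fun m hm hY => ?_, fun m hm hZ => ?_, ?_⟩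
  · exact hYB.invRotate.ge₂ t (t.ge_antitone (by lia) _ hB'') hY
  · exact hZB.invRotate.ge₂ t (t.ge_antitone (by lia) _ hB'') hZ
  · rw [eulerChar_top hb ht hYB hY'' hB' hB, eulerChar_truncation hb hZB hZ' hB]
    ring

/-- The Euler characteristic is additive on distinguished triangles. -/
lemma eulerChar_extension (hb : IsBounded t) (ht : IsAlgebraicHeart t) {X Y Z : D}
    (h : IsExtension X Y Z) : eulerChar t Y = eulerChar t X + eulerChar t Z := by
  have key : ∀ (m : ℤ) (k : ℕ) (X Y Z : D), IsExtension X Y Z → t.le (m - 1 + k) X →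
      t.le (m - 1 + k) Y → t.le (m - 1 + k) Z → t.ge m X → t.ge m Y →
      eulerChar t Y = eulerChar t X + eulerChar t Z := by
    intro m k
    induction k with
    | zero =>
      intro X Y Z h hX hY _ hX' hY'
      have hX0 := isZero_of_le_of_ge t hX hX' (by simp)
      obtain ⟨e⟩ := h.nonempty_iso_of_isZero_left hX0
      rw [eulerChar_of_isZero hX0, eulerChar_congr e, zero_add]
    | succ k ih =>
      intro X Y Z h hX hY hZ hX' hY'
      -- peel off the top degree of each of the three objects in turn, rotating in between
      obtain ⟨Y₁, Z₁, h₁, hY₁, hZ₁, hY₁', -, e₁⟩ := exists_peel hb ht h hX hZ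
      have hle : m ≤ m - 1 + ((k + 1 : ℕ) : ℤ) := by push_cast; lia
      obtain ⟨X₂, Y₂, h₂, hX₂, hY₂, hX₂', hY₂', e₂⟩ := exists_peel hb ht h₁.invRotate
        (n := m - 1 + ((k + 1 : ℕ) : ℤ))
        ((le_shift_iff t (m - 1 + k) (-1) _ (by push_cast; lia)).2
          (t.le_monotone (by push_cast; lia) _ hZ₁)) hY₁
      obtain ⟨Z₃, X₃, h₃, hZ₃, hX₃, -, hX₃', e₃⟩ := exists_peel hb ht h₂.invRotate
        (n := m - 1 + ((k + 1 : ℕ) : ℤ))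
        ((le_shift_iff t (m - 1 + k) (-1) _ (by push_cast; lia)).2
          (t.le_monotone (by push_cast; lia) _ hY₂)) hX₂
      have h₄ := h₃.rotate.rotate.congr (Iso.refl _) (shiftNegShift Y₂ (1 : ℤ)) (Iso.refl _)
      have e₄ := ih _ _ _ h₄ (t.le_monotone (by push_cast; lia) _ hX₃)
        (t.le_monotone (by push_cast; lia) _ hY₂)
        ((le_shift_iff t (m - 1 + ((k + 1 : ℕ) : ℤ)) 1 _ (by push_cast; lia)).2 hZ₃)
        (hX₃' m hle (hX₂' m hle hX')) (hY₂' m hle (hY₁' m hle hY'))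
      rw [eulerChar_shift_one] at e₄
      rw [eulerChar_shift_neg_one] at e₃
      lia
  obtain ⟨a₁, b₁, hX, hX'⟩ := exists_le_ge t hb X
  obtain ⟨a₂, b₂, hY, hY'⟩ := exists_le_ge t hb Y
  obtain ⟨a₃, b₃, hZ, hZ'⟩ := exists_le_ge t hb Z
  refine key (min a₁ a₂) (max b₁ (max b₂ b₃) + 1 - min a₁ a₂).toNat X Y Z h
    (t.le_monotone (by lia) _ hX) (t.le_monotone (by lia) _ hY) (t.le_monotone (by lia) _ hZ)
    (t.ge_antitone (min_le_left _ _) _ hX') (t.ge_antitone (min_le_right _ _) _ hY')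

lemma exists_eulerChar_hom (hb : IsBounded t) (ht : IsAlgebraicHeart t) :
    ∃ φ : GrothendieckGroup D →+ ℤ, ∀ X : D, φ (grothendieckClass X) = eulerChar t X := by
  refine ⟨QuotientAddGroup.lift (grothendieckRelations D) (FreeAbelianGroup.lift (eulerChar t)) ?_,
    fun X => FreeAbelianGroup.lift_apply_of _ _⟩
  rw [grothendieckRelations, AddSubgroup.closure_le]
  rintro _ ⟨T, hT, rfl⟩
  have := eulerChar_extension hb ht (IsExtension.of_triangle T hT)
  simp [this]

/-- Nonzero objects of `A[1]` and of `A`, for an algebraic heart `A`, have different classes in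
the Grothendieck group. -/
lemma grothendieckClass_ne (hb : IsBounded t) (ht : IsAlgebraicHeart t) {X Y : D}
    (hX : t.heart (X⟦(-1 : ℤ)⟧)) (hX0 : ¬ IsZero X) (hY : t.heart Y) (hY0 : ¬ IsZero Y) :
    grothendieckClass X ≠ grothendieckClass Y := by
  intro h
  obtain ⟨φ, hφ⟩ := exists_eulerChar_hom hb ht
  have hpos : ∀ {Z : D}, t.heart Z → ¬ IsZero Z → 0 < eulerChar t Z := by
    intro Z hZ hZ0
    rw [eulerChar_of_le_of_ge hZ.1 hZ.2, heartLength_congr ((shiftFunctorZero D ℤ).app Z)]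
    simpa using heartLength_pos ht hZ hZ0
  have h₁ := hpos hX (fun h0 => hX0 ((isZero_shift_iff (-1)).1 h0))
  have h₂ := hpos hY hY0
  rw [eulerChar_shift_neg_one, ← hφ, h, hφ] at h₁
  lia

end Euler

section Reachability

variable {D : Type u} [Category.{v} D] [Preadditive D] [HasZeroObject D] [HasShift D ℤ]
  [∀ n : ℤ, (shiftFunctor D n).Additive] [Pretriangulated D] [IsTriangulated D]
  {t s s' : TStructure D}

/-! ### Simple tilts between intermediate t-structures -/

lemma ge_one_le_ge_zero (h : s.le 0 ≤ t.le 1) : t.ge 1 ≤ s.ge 0 := by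
  intro X hX
  rw [ge_iff_orthogonal s (show (-1 : ℤ) + 1 = 0 by lia)]
  intro Y f hY
  refine hom_eq_zero t f (m := 0) ?_ hX (by lia)
  rw [← le_shift_iff t 0 (-1) 1 (by lia)]
  exact h _ ((le_shift_iff s (-1) (-1) 0 (by lia)).2 hY)

lemma not_le_shift_of_heart {X : D} (hX : s.ge 0 X) (hX0 : ¬ IsZero X) :
    ¬ s.le 0 (X⟦(-1 : ℤ)⟧) := by
  intro h
  exact hX0 ((isZero_shift_iff (-1)).1
    (isZero_of_le_of_ge s h ((ge_shift_iff s 0 (-1) 1 (by lia)).2 hX) (by lia)))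

/-- A t-structure that is strictly intermediate with respect to `s` contains `S[-1]` for some
simple object `S` of the heart of `s`. -/
lemma exists_simple_shift_le (hs : IsAlgebraicHeart s) (h₁ : s.le 0 ≤ s'.le 0)
    (h₂ : s'.le 0 ≤ s.le 1) (hne : s ≠ s') :
    ∃ S : HeartCat s, Simple S ∧ s'.le 0 (S.obj⟦(-1 : ℤ)⟧) := by
  obtain ⟨F, hF⟩ := isTorsionClass_torsionOf h₁ h₂
  by_cases h : ∃ X : HeartCat s, torsionOf s s' X ∧ ¬ IsZero X
  · obtain ⟨X, hX, hX0⟩ := h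
    exact exists_simple_of_torsion hs hF hX hX0
  · push Not at h
    refine absurd (tStructure_ext (le_antisymm h₁ ?_)) hne
    rw [← tilt_of_intermediate h₁ h₂, IsHeartTorsionPair.tilt_le_zero]
    rintro X ⟨P, Q, hP, hQ, hPQ⟩
    obtain ⟨e⟩ := hPQ.nonempty_iso_of_isZero_right
      ((isZero_shift_iff (-1)).2 ((isZero_iff_isZero_obj s).1 (h ⟨Q, hQ.1⟩ hQ.2)))
    exact (s.le 0).prop_of_iso e hP

lemma le_shift_of_extClosure {S X : HeartCat s} (hS : s'.le 0 (S.obj⟦(-1 : ℤ)⟧))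
    (hX : extClosure S X) : s'.le 0 (X.obj⟦(-1 : ℤ)⟧) := by
  induction hX with
  | zero X hX =>
    exact le_of_isZero s' ((isZero_shift_iff (-1)).2 ((isZero_iff_isZero_obj s).1 hX)) 0
  | self => exact hS
  | iso X Y e _ ih =>
    exact (s'.le 0).prop_of_iso ((shiftFunctor D (-1 : ℤ)).mapIso (s.heart.ι.mapIso e)) ih
  | ext E hE _ _ ih₁ ih₃ => exact ((isExtension_of_shortExact s hE).shift (-1)).le₂ s' ih₁ ih₃

/-- The simple tilt at `S` is the smallest t-structure above `s` whose aisle contains `S[-1]`. -/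
lemma tilt_extClosure_le {S : HeartCat s} {F : ObjectProperty (HeartCat s)}
    (h : IsTorsionPair (extClosure S) F) (h₁ : s.le 0 ≤ s'.le 0)
    (hS : s'.le 0 (S.obj⟦(-1 : ℤ)⟧)) : h.ambient.tilt.le 0 ≤ s'.le 0 := by
  rw [IsHeartTorsionPair.tilt_le_zero]
  rintro X ⟨P, Q, hP, hQ, hPQ⟩
  exact hPQ.le₂ s' (h₁ _ hP) (le_shift_of_extClosure hS hQ.2)

lemma shift_mem_tilt_extClosure {S : HeartCat s} {F : ObjectProperty (HeartCat s)}
    (h : IsTorsionPair (extClosure S) F) : h.ambient.tilt.le 0 (S.obj⟦(-1 : ℤ)⟧) :=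
  (h.ambient.shift_mem_tilt_iff S.2).2 ((ambient_obj s).2 .self)

/-- Below an intermediate t-structure `s'` there is room for a simple tilt of `s`. -/
lemma exists_isSimpleLeftTilt (hb : IsBounded s) (hs : IsAlgebraicHeart s)
    (h₁ : s.le 0 ≤ s'.le 0) (h₂ : s'.le 0 ≤ s.le 1) (hne : s ≠ s') :
    ∃ (r : TStructure D) (S : HeartCat s), Simple S ∧ r.le 0 (S.obj⟦(-1 : ℤ)⟧) ∧
      IsBounded r ∧ IsSimpleLeftTilt s r ∧ s.le 0 ≤ r.le 0 ∧ r.le 0 ≤ s'.le 0 := by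
  obtain ⟨S, hS, hS'⟩ := exists_simple_shift_le hs h₁ h₂ hne
  have h := isTorsionPair_extClosure (fun E => (hs.1 E).2) S
  exact ⟨h.ambient.tilt, S, hS, shift_mem_tilt_extClosure h, h.ambient.tilt_isBounded hb,
    ⟨hs, S, hS, isLeftTilt_tilt hb h⟩, h.ambient.le_tilt, tilt_extClosure_le h h₁ hS'⟩

lemma heart_of_shift_le {S : D} (hS : s.heart S) (h₁ : t.le 0 ≤ s.le 0)
    (hS' : t.le 1 (S⟦(-1 : ℤ)⟧)) : t.heart S :=
  ⟨(le_shift_iff t 0 (-1) 1 (by lia)).1 hS', ge_le_ge_of_le h₁ 0 _ hS.2⟩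

/-- Endo-triviality only depends on the object of the triangulated category, hence follows from
Schur's lemma for an object that is simple in another heart. -/
lemma isEndoTrivial_of_simple (S : HeartCat s) [Simple S] (hS : t.heart S.obj) :
    IsEndoTrivial (⟨S.obj, hS⟩ : HeartCat t) := by
  constructor
  · refine ⟨𝟙 _, 0, fun h => Simple.not_isZero S ?_⟩
    rw [isZero_iff_isZero_obj, IsZero.iff_id_eq_zero]
    exact congrArg (fun f => f.hom) h
  · intro f hf
    rw [isUnit_iff_isIso]
    let φ : S ⟶ S := ObjectProperty.homMk f.hom
    have hφ : φ ≠ 0 := fun h => hf (t.heart.ι.map_injective (congrArg (fun f => f.hom) h))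
    have : IsIso φ := isIso_of_hom_simple hφ
    have : IsIso (t.heart.ι.map f) := inferInstanceAs (IsIso (s.heart.ι.map φ))
    exact isIso_of_reflects_iso f t.heart.ι

/-! ### Reachability of the intermediate t-structures -/

/-- The classes of the endo-trivial objects in the torsion class attached to `s`. -/
def endoTrivialTorsionClasses (t s : TStructure D) : Set (GrothendieckGroup D) :=
  {c | ∃ E : HeartCat t, IsEndoTrivial E ∧ grothendieckClass E.obj = c ∧ torsionOf t s E}

/-- A simple tilt between intermediate t-structures enlarges the set of classes of endo-trivial
torsion objects: the class of the simple object `S` is new, since an endo-trivial object `E` that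
was torsion before has `E[-1]` in the heart of `s`, so that `[E]` and `[S]` have Euler
characteristics of opposite signs. -/
lemma endoTrivialTorsionClasses_ssubset (hb : IsBounded s) (hs : IsAlgebraicHeart s)
    (h₀ : t.le 0 ≤ s.le 0) (h₁ : s.le 0 ≤ s'.le 0) (h₂ : s'.le 0 ≤ t.le 1) (S : HeartCat s)
    [Simple S] (hS : s'.le 0 (S.obj⟦(-1 : ℤ)⟧)) :
    endoTrivialTorsionClasses t s ⊂ endoTrivialTorsionClasses t s' := by
  have hSt := heart_of_shift_le S.2 h₀ (h₂ _ hS)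
  have hsub : endoTrivialTorsionClasses t s ⊆ endoTrivialTorsionClasses t s' :=
    fun c ⟨E, hE, hc, hEs⟩ => ⟨E, hE, hc, h₁ _ hEs⟩
  rw [Set.ssubset_iff_of_subset hsub]
  refine ⟨grothendieckClass S.obj, ⟨⟨S.obj, hSt⟩, isEndoTrivial_of_simple S hSt, rfl, hS⟩, ?_⟩
  rintro ⟨E, hE, hc, hEs⟩
  refine grothendieckClass_ne hb hs (X := E.obj) ⟨hEs, ?_⟩ ?_ S.2 ?_ hc
  · exact ge_one_le_ge_zero (h₁.trans h₂) _ ((ge_shift_iff t 0 (-1) 1 (by lia)).2 E.2.2)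
  · intro h0
    have hE0 := (isZero_iff_isZero_obj t).2 h0
    obtain ⟨f, g, hfg⟩ := hE.1
    exact hfg (hE0.eq_of_src _ _)
  · exact fun h0 => Simple.not_isZero S ((isZero_iff_isZero_obj s).2 h0)

/-- Under either finiteness assumption, a natural number strictly increases under the simple
tilts between intermediate t-structures and stays bounded. -/
lemma exists_bounded_measure
    (hfinite : (endoTrivialClasses t).Finite ∨ Finite (TorsionClass t)) :
    ∃ (μ : TStructure D → ℕ) (B : ℕ), (∀ s, μ s ≤ B) ∧
      ∀ (s s' : TStructure D), IsBounded s → IsAlgebraicHeart s → t.le 0 ≤ s.le 0 →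
        s.le 0 ≤ s'.le 0 → s'.le 0 ≤ t.le 1 →
        (∃ S : HeartCat s, Simple S ∧ s'.le 0 (S.obj⟦(-1 : ℤ)⟧)) → μ s < μ s' := by
  obtain hfin | hfin := hfinite
  · have hsub : ∀ s, endoTrivialTorsionClasses t s ⊆ endoTrivialClasses t :=
      fun s c ⟨E, hE, hc, _⟩ => ⟨E, hE, hc⟩
    refine ⟨fun s => (endoTrivialTorsionClasses t s).ncard, (endoTrivialClasses t).ncard,
      fun s => Set.ncard_le_ncard (hsub s) hfin, ?_⟩
    rintro s s' hb hs h₀ h₁ h₂ ⟨S, hS, hS'⟩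
    exact Set.ncard_lt_ncard (endoTrivialTorsionClasses_ssubset hb hs h₀ h₁ h₂ S hS')
      (hfin.subset (hsub s'))
  · refine ⟨fun s => {T : TorsionClass t | T.1 ≤ torsionOf t s}.ncard,
      (Set.univ : Set (TorsionClass t)).ncard,
      fun s => Set.ncard_le_ncard (Set.subset_univ _) (Set.toFinite _), ?_⟩
    rintro s s' hb hs h₀ h₁ h₂ ⟨S, hS, hS'⟩
    refine Set.ncard_lt_ncard ?_ (Set.toFinite _)
    have hsub : {T : TorsionClass t | T.1 ≤ torsionOf t s} ⊆
        {T : TorsionClass t | T.1 ≤ torsionOf t s'} := fun T hT X hX => h₁ _ (hT _ hX)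
    rw [Set.ssubset_iff_of_subset hsub]
    refine ⟨⟨torsionOf t s', isTorsionClass_torsionOf (h₀.trans h₁) h₂⟩, le_refl (torsionOf t s'),
      fun hle => ?_⟩
    have hSt := heart_of_shift_le S.2 h₀ (h₂ _ hS')
    exact not_le_shift_of_heart S.2.2
      (fun h0 => Simple.not_isZero S ((isZero_iff_isZero_obj s).2 h0)) (hle ⟨S.obj, hSt⟩ hS')

/-- Every intermediate t-structure is obtained by a finite sequence of simple tilts. -/
lemma reflTransGen_of_intermediate (hb : IsBounded t) (htilt : CanTiltIndefinitely t)
    (hfinite : (endoTrivialClasses t).Finite ∨ Finite (TorsionClass t))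
    (h₁ : t.le 0 ≤ s'.le 0) (h₂ : s'.le 0 ≤ t.le 1) :
    Relation.ReflTransGen IsSimpleLeftTilt t s' := by
  obtain ⟨μ, B, hμ, hlt⟩ := exists_bounded_measure hfinite
  have key : ∀ (k : ℕ) (s : TStructure D), B - μ s < k → IsBounded s →
      Relation.ReflTransGen IsSimpleLeftTilt t s → t.le 0 ≤ s.le 0 → s.le 0 ≤ s'.le 0 →
      Relation.ReflTransGen IsSimpleLeftTilt t s' := by
    intro k
    induction k with
    | zero => intro s hk; lia
    | succ k ih =>
      intro s hk hbs hts hs hs'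
      by_cases hne : s = s'
      · exact hne ▸ hts
      · have halg := (htilt s hts).1
        obtain ⟨r, S, hS, hSr, hbr, hsr, hsr', hr⟩ := exists_isSimpleLeftTilt hbs halg hs'
          (h₂.trans (le_le_le_of_le hs 1)) hne
        have := hlt s r hbs halg hs hsr' (hr.trans h₂) ⟨S, hS, hSr⟩
        have := hμ r
        exact ih r (by lia) hbr (hts.tail hsr) (hs.trans hsr') hr
  exact key (B - μ t + 1) t (by lia) hb .refl le_rfl h₁

/-! ### Covering relations and simple tilts -/

lemma isSimpleLeftTilt_of_covBy (hb : IsBounded t) {T₁ T₂ : TorsionClass t} (h : T₂ ⋖ T₁)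
    (halg : IsAlgebraicHeart (torsionClassOrderIso hb T₂).str) :
    IsSimpleLeftTilt (torsionClassOrderIso hb T₂).str (torsionClassOrderIso hb T₁).str := by
  let e := torsionClassOrderIso hb
  have hle : (e T₂).str.le 0 ≤ (e T₁).str.le 0 := e.le_iff_le.2 h.1.le
  have hne : (e T₂).str ≠ (e T₁).str := by
    intro heq
    have : T₁ ≤ T₂ := e.le_iff_le.1 (show (e T₁).str.le 0 ≤ (e T₂).str.le 0 by rw [heq])
    exact h.1.not_ge this
  obtain ⟨r, S, hS, hSr, hbr, hr, h₁, h₂⟩ := exists_isSimpleLeftTilt (e T₂).bounded halg hle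
    ((e T₁).str_le.trans (le_le_le_of_le (e T₂).le_str 1)) hne
  let C : IntermediateTStructure t :=
    ⟨r, hbr, (e T₂).le_str.trans h₁, h₂.trans (e T₁).str_le⟩
  obtain ⟨T, hT⟩ := e.surjective C
  have h₁' : T₂ ≤ T := e.le_iff_le.1 (by rw [hT]; exact h₁)
  have h₂' : T ≤ T₁ := e.le_iff_le.1 (by rw [hT]; exact h₂)
  have hnot : ¬ T ≤ T₂ := by
    intro hle'
    have hle'' : (e T).str.le 0 ≤ (e T₂).str.le 0 := e.le_iff_le.2 hle'
    rw [hT] at hle''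
    exact not_le_shift_of_heart S.2.2
      (fun h0 => Simple.not_isZero S ((isZero_iff_isZero_obj _).2 h0)) (hle'' _ hSr)
  have hTT : T = T₁ := by
    by_contra hTT
    exact h.2 (lt_of_le_not_ge h₁' hnot) (lt_of_le_of_ne h₂' hTT)
  rw [hTT] at hT
  change IsSimpleLeftTilt _ (e T₁).str
  rw [hT]
  exact hr

lemma covBy_of_isSimpleLeftTilt (hb : IsBounded t) {T₁ T₂ : TorsionClass t}
    (h : IsSimpleLeftTilt (torsionClassOrderIso hb T₂).str (torsionClassOrderIso hb T₁).str) :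
    T₂ ⋖ T₁ := by
  let e := torsionClassOrderIso hb
  obtain ⟨halg, S, hS, hL⟩ := h
  -- bounded t-structures are determined by their hearts, so `e T₁` is the simple tilt at `S`
  have heq : (e T₁).str = hL.1.ambient.tilt := hL.eq_tilt (e T₂).bounded
  have hSr : (e T₁).str.le 0 (S.obj⟦(-1 : ℤ)⟧) := by
    rw [heq]
    exact shift_mem_tilt_extClosure hL.1
  have hS0 : ¬ IsZero S.obj := fun h0 => Simple.not_isZero S ((isZero_iff_isZero_obj _).2 h0)
  have hle : T₂ ≤ T₁ := e.le_iff_le.1 (by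
    change (e T₂).str.le 0 ≤ (e T₁).str.le 0
    rw [heq]
    exact hL.1.ambient.le_tilt)
  refine ⟨lt_of_le_not_ge hle fun hle' => ?_, fun T h₁ h₂ => ?_⟩
  · have hle'' : (e T₁).str.le 0 ≤ (e T₂).str.le 0 := e.le_iff_le.2 hle'
    exact not_le_shift_of_heart S.2.2 hS0 (hle'' _ hSr)
  · have hT₁ : (e T₂).str.le 0 ≤ (e T).str.le 0 := e.le_iff_le.2 h₁.le
    have hT₂ : (e T).str.le 0 ≤ (e T₁).str.le 0 := e.le_iff_le.2 h₂.le
    have hne : (e T₂).str ≠ (e T).str := by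
      intro heq'
      have : T ≤ T₂ := e.le_iff_le.1 (show (e T).str.le 0 ≤ (e T₂).str.le 0 by rw [heq'])
      exact h₁.not_ge this
    obtain ⟨S', hS', hST⟩ := exists_simple_shift_le halg hT₁
      ((e T).str_le.trans (le_le_le_of_le (e T₂).le_str 1)) hne
    have hext : extClosure S S' := by
      have := hT₂ _ hST
      rw [heq, IsHeartTorsionPair.shift_mem_tilt_iff _ S'.2] at this
      exact (ambient_obj _).1 this
    -- a simple object of `⟨S⟩` is not torsion-free, hence receives a nonzero map from `S`
    obtain ⟨f, hf⟩ : ∃ f : S ⟶ S', f ≠ 0 := by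
      by_contra! hf
      refine Simple.not_isZero S' ((IsZero.iff_id_eq_zero _).2 ?_)
      exact extClosure_hom_eq_zero _ hext hf
    have : IsIso f := isIso_of_hom_simple hf
    have hST' : (e T).str.le 0 (S.obj⟦(-1 : ℤ)⟧) :=
      ((e T).str.le 0).prop_of_iso ((shiftFunctor D (-1 : ℤ)).mapIso
        ((TStructure.heart _).ι.mapIso (asIso f))).symm hST
    have : T₁ ≤ T := e.le_iff_le.1 (by
      change (e T₁).str.le 0 ≤ (e T).str.le 0
      rw [heq]
      exact tilt_extClosure_le hL.1 hT₁ hST')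
    exact h₂.not_ge this

end Reachability

end HeartTilting

end

theorem mainTheorem4 {D : Type u} [Category.{v} D] [Preadditive D] [HasZeroObject D]
    [HasShift D ℤ] [∀ n : ℤ, (shiftFunctor D n).Additive] [Pretriangulated D] [IsTriangulated D]
    (t : TStructure D) (hbounded : HeartTilting.IsBounded t)
    (halgebraic : HeartTilting.IsAlgebraicHeart t)
    (htilt : HeartTilting.CanTiltIndefinitely t)
    (hfinite : (HeartTilting.endoTrivialClasses t).Finite ∨
      Finite (HeartTilting.TorsionClass t)) :
    ∃ e : HeartTilting.TorsionClass t ≃o HeartTilting.IntermediateTStructure t,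
      (∀ T : HeartTilting.TorsionClass t, ∃ F : ObjectProperty (HeartTilting.HeartCat t),
        HeartTilting.IsLeftTilt t T.1 F (e T).str) ∧
      ∀ T₁ T₂ : HeartTilting.TorsionClass t,
        HeartTilting.HasseArrow t T₁ T₂ ↔ HeartTilting.ExchangeArrow t (e T₂) (e T₁) := by
  refine ⟨HeartTilting.torsionClassOrderIso hbounded,
    HeartTilting.isLeftTilt_torsionClassOrderIso hbounded, fun T₁ T₂ => ⟨fun h => ?_, fun h => ?_⟩⟩
  · refine HeartTilting.isSimpleLeftTilt_of_covBy hbounded h (htilt _ ?_).1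
    exact HeartTilting.reflTransGen_of_intermediate hbounded htilt hfinite
      (HeartTilting.torsionClassOrderIso hbounded T₂).le_str
      (HeartTilting.torsionClassOrderIso hbounded T₂).str_le
  · exact HeartTilting.covBy_of_isSimpleLeftTilt hbounded h
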